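/- Let $w:[0,1]^2\to[0,1]$ be a graphon (a symmetric measurable function), and let $K>0$ be such that $|w(x,y)-w(x',y')|\le K(|x-x'|+|y-y'|)$ for all $x,y,x',y'\in[0,1]$. Fix $\tau\in[0,1)$ and put $\rho_N=N^{-\tau}$. For each integer $N\ge 1$ let $G^{(N)}$ be a random simple graph on $\{1,\dots,N\}$ in which, independently for $1\le i<j\le N$, the edge $ij$ is present with probability $\rho_N\,w(i/N,j/N)$, and let $\widehat P^{(N)}$ be its adjacency matrix. Put $P^{(N)}_{ij}=w(i/N,j/N)$ for $1\le i,j\le N$, $I_1^N=[0,1/N]$, $I_i^N=((i-1)/N,i/N]$ for $2\le i\le N$, and $$w_N(x,y)=\sum_{i,j=1}^N P^{(N)}_{ij}1_{I_i^N}(x)1_{I_j^N}(y),\qquad \widehat w_N(x,y)=\sum_{i,j=1}^N \widehat P^{(N)}_{ij}1_{I_i^N}(x)1_{I_j^N}(y).$$ The Laplacian of a graphon $u$ is the bounded operator on $L^2([0,1])$ given by $f\mapsto \int_0^1 u(\cdot,y)\,(f(\cdot)-f(y))\,dy$. Let $\mathbb L,\mathbb L_N,\widehat{\mathbb L}_N$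 be the Laplacians of $w,w_N,\widehat w_N$, and let $\|\cdot\|$ be the operator norm. Let $d_{\mathrm{MAX}}=\max_{x\in[0,1]}\int_0^1 w(x,y)\,dy$ and $\varepsilon_\gamma(N)=\exp(-(\log N)^\gamma)$. For $\varepsilon\in(0,1)$ and $\gamma>1$ let $N_1=N_1(w,\tau,\varepsilon)$, respectively $N_1'=N_1'(w,\tau,\gamma)$, be the least integer $n\ge 1$ such that for every $N\ge n$ $$d_{\mathrm{MAX}}\ \ge\ \frac{4\log(4N/\varepsilon)}{9\rho_N N}+\frac{2K}{N},\qquad\text{respectively}\qquad d_{\mathrm{MAX}}\ \ge\ \frac{4\log(4N/\varepsilon_\gamma(N))}{9\rho_N N}+\frac{2K}{N}$$ (in the degenerate case $d_{\mathrm{MAX}}=0$, where no such $n$ exists, put $N_1=N_1'=0$). Then: 1. $\|\mathbb L_N-\mathbb L\|\le \dfrac{4K}{N}$ for every $N\ge1$. 2. For every $\varepsilon\in(0,1)$, $N_1$ is well defined if $d_{\mathrm{MAX}}>0$, and for every $N\ge \max(1,N_1)$ $$\mathbb P\left(\left\|\rho_N^{-1}\widehat{\mathbb L}_N-\mathbb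 L\right\|\le 4\sqrt{\frac{\log(4N/\varepsilon)}{\rho_N N}}+\frac{4K}{N}\right)\ge 1-\varepsilon .$$ 3. For every $\gamma>1$, $N_1'$ is well defined if $d_{\mathrm{MAX}}>0$, and for every $N\ge \max(1,N_1')$ $$\mathbb P\left(\left\|\rho_N^{-1}\widehat{\mathbb L}_N-\mathbb L\right\|\le 4\sqrt{\frac{\log(4N/\varepsilon_\gamma(N))}{\rho_N N}}+\frac{4K}{N}\right)\ge 1-\varepsilon_\gamma(N) .$$ -/

import Mathlib

open MeasureTheory ProbabilityTheory

/-- A graphon: a symmetric measurable function `[0,1]² → [0,1]`. -/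
structure Graphon where
  toFun : unitInterval → unitInterval → ℝ
  measurable' : Measurable (Function.uncurry toFun)
  symm' : ∀ x y, toFun x y = toFun y x
  nonneg' : ∀ x y, 0 ≤ toFun x y
  le_one' : ∀ x y, toFun x y ≤ 1

namespace Graphon

instance : CoeFun Graphon (fun _ => unitInterval → unitInterval → ℝ) := ⟨Graphon.toFun⟩

/-- The Hilbert space `L²([0,1])` of real functions, with Lebesgue measure. -/
abbrev L2 : Type := Lp ℝ 2 (volume : Measure unitInterval)

/-- The degree `d(x) = ∫₀¹ w(x,y) dy`. -/
noncomputable def degree (w : Graphon) (x : unitInterval) : ℝ := ∫ y, w x y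

/-- `d_MAX = max_{x ∈ [0,1]} d(x)`. -/
noncomputable def maxDegree (w : Graphon) : ℝ := ⨆ x, w.degree x

/-- Lipschitz continuity with constant `K` for the `ℓ¹` distance on `[0,1]²`. -/
def IsLipschitz (w : Graphon) (K : ℝ) : Prop :=
  ∀ x y x' y' : unitInterval,
    |w x y - w x' y'| ≤ K * (|(x : ℝ) - (x' : ℝ)| + |(y : ℝ) - (y' : ℝ)|)

/-- The function `x ↦ ∫₀¹ w(x,y) (f(x) - f(y)) dy`. -/
noncomputable def laplacianFun (w : Graphon) (f : unitInterval → ℝ) (x : unitInterval) : ℝ :=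
  ∫ y, w x y * (f x - f y)

theorem integrable_coe (f : L2) : Integrable (f : unitInterval → ℝ) volume :=
  (Lp.memLp f).integrable (by norm_num)

theorem measurable_right (w : Graphon) (x : unitInterval) : Measurable (w x) :=
  w.measurable'.comp measurable_prodMk_left

theorem integrable_mul (w : Graphon) {f : unitInterval → ℝ} (hf : Integrable f volume)
    (x : unitInterval) : Integrable (fun y => w x y * f y) volume :=
  hf.bdd_mul (c := 1) (w.measurable_right x).aestronglyMeasurable
    (Filter.Eventually.of_forall fun y => by
      rw [Real.norm_eq_abs, abs_of_nonneg (w.nonneg' x y)]; exact w.le_one' x y)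

theorem laplacianFun_add (w : Graphon) {f g : unitInterval → ℝ} (hf : Integrable f volume)
    (hg : Integrable g volume) (x : unitInterval) :
    w.laplacianFun (f + g) x = w.laplacianFun f x + w.laplacianFun g x := by
  unfold laplacianFun
  have h1 : Integrable (fun y => w x y * (f x - f y)) volume :=
    w.integrable_mul ((integrable_const (f x)).sub hf) x
  have h2 : Integrable (fun y => w x y * (g x - g y)) volume :=
    w.integrable_mul ((integrable_const (g x)).sub hg) x
  rw [← integral_add h1 h2]
  refine integral_congr_ae (Filter.Eventually.of_forall fun y => ?_)
  simp only [Pi.add_apply]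
  ring

theorem laplacianFun_smul (w : Graphon) (c : ℝ) (f : unitInterval → ℝ) (x : unitInterval) :
    w.laplacianFun (c • f) x = c * w.laplacianFun f x := by
  unfold laplacianFun
  rw [← integral_const_mul]
  refine integral_congr_ae (Filter.Eventually.of_forall fun y => ?_)
  simp only [Pi.smul_apply, smul_eq_mul]
  ring

theorem laplacianFun_congr (w : Graphon) {f g : unitInterval → ℝ} (h : f =ᵐ[volume] g) :
    w.laplacianFun f =ᵐ[volume] w.laplacianFun g := by
  filter_upwards [h] with x hx
  refine integral_congr_ae ?_
  filter_upwards [h] with y hy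
  rw [hx, hy]

theorem abs_laplacianFun_le (w : Graphon) {f : unitInterval → ℝ} (hf : Integrable f volume)
    (x : unitInterval) : |w.laplacianFun f x| ≤ |f x| + ∫ y, |f y| := by
  have h1 : |w.laplacianFun f x| ≤ ∫ y, (|f x| + |f y|) := by
    rw [← Real.norm_eq_abs]
    refine norm_integral_le_of_norm_le (g := fun y => |f x| + |f y|)
      ((integrable_const |f x|).add hf.abs) (Filter.Eventually.of_forall fun y => ?_)
    rw [Real.norm_eq_abs, abs_mul, abs_of_nonneg (w.nonneg' x y)]
    calc w x y * |f x - f y| ≤ 1 * |f x - f y| :=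
          mul_le_mul_of_nonneg_right (w.le_one' x y) (abs_nonneg _)
      _ ≤ |f x| + |f y| := by rw [one_mul]; exact abs_sub _ _
  rw [integral_add (integrable_const _) hf.abs] at h1
  simpa using h1

theorem laplacianFun_aestronglyMeasurable (w : Graphon) (f : L2) :
    AEStronglyMeasurable (w.laplacianFun f) volume := by
  have hf : StronglyMeasurable (f : unitInterval → ℝ) := Lp.stronglyMeasurable f
  have h : StronglyMeasurable (Function.uncurry fun x y : unitInterval => w x y * (f x - f y)) :=
    w.measurable'.stronglyMeasurable.mul
      ((hf.comp_measurable measurable_fst).sub (hf.comp_measurable measurable_snd))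
  exact h.integral_prod_right.aestronglyMeasurable

theorem memLp_bound (f : L2) :
    MemLp (fun x => |f x| + ∫ y, |f y|) 2 (volume : Measure unitInterval) :=
  (Lp.memLp f).abs.add (memLp_const _)

theorem memLp_laplacianFun (w : Graphon) (f : L2) : MemLp (w.laplacianFun f) 2 volume :=
  (memLp_bound f).mono (w.laplacianFun_aestronglyMeasurable f)
    (Filter.Eventually.of_forall fun x =>
      (w.abs_laplacianFun_le (integrable_coe f) x).trans (le_abs_self _))

theorem integral_abs_le (f : L2) : ∫ y, |f y| ≤ ‖f‖ := by
  have h1 : ∫ y, |f y| = (eLpNorm f 1 volume).toReal := by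
    rw [eLpNorm_one_eq_lintegral_enorm]
    exact integral_norm_eq_lintegral_enorm (Lp.aestronglyMeasurable f)
  rw [h1, Lp.norm_def]
  exact ENNReal.toReal_mono (Lp.eLpNorm_ne_top f)
    (eLpNorm_le_eLpNorm_of_exponent_le (by norm_num) (Lp.aestronglyMeasurable f))

theorem norm_laplacian_le (w : Graphon) (f : L2) :
    ‖(w.memLp_laplacianFun f).toLp (w.laplacianFun f)‖ ≤ 2 * ‖f‖ := by
  have hc : MemLp (fun _ : unitInterval => ∫ y, |f y|) 2 volume := memLp_const _
  have h1 : ‖(w.memLp_laplacianFun f).toLp (w.laplacianFun f)‖ ≤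
      ‖(Lp.memLp f).abs.toLp _ + hc.toLp _‖ := by
    refine Lp.norm_le_norm_of_ae_le ?_
    filter_upwards [(w.memLp_laplacianFun f).coeFn_toLp,
      Lp.coeFn_add ((Lp.memLp f).abs.toLp _) (hc.toLp _),
      (Lp.memLp f).abs.coeFn_toLp, hc.coeFn_toLp] with x h1 h2 h3 h4
    rw [h1, h2, Pi.add_apply, h3, h4]
    exact (w.abs_laplacianFun_le (integrable_coe f) x).trans (le_abs_self _)
  have h2 : ‖(Lp.memLp f).abs.toLp _‖ ≤ ‖f‖ := by
    refine Lp.norm_le_norm_of_ae_le ?_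
    filter_upwards [(Lp.memLp f).abs.coeFn_toLp] with x h1
    rw [h1]
    simp
  have h3 : ‖hc.toLp _‖ ≤ ‖f‖ := by
    have h0 : 0 ≤ ∫ y, |f y| := integral_nonneg fun _ => abs_nonneg _
    refine le_trans (le_of_eq ?_) (integral_abs_le f)
    rw [Lp.norm_toLp, eLpNorm_const _ (by norm_num) (NeZero.ne _)]
    simp [abs_of_nonneg h0]
  calc _ ≤ _ := h1
    _ ≤ _ := norm_add_le _ _
    _ ≤ 2 * ‖f‖ := by linarith

/-- The graphon Laplacian, the bounded operator on `L²([0,1])` given by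
`(𝕃 f)(x) = ∫₀¹ w(x,y) (f(x) - f(y)) dy`. -/
noncomputable def laplacian (w : Graphon) : L2 →L[ℝ] L2 :=
  LinearMap.mkContinuous
    { toFun := fun f => (w.memLp_laplacianFun f).toLp (w.laplacianFun f)
      map_add' := fun f g => by
        rw [← MemLp.toLp_add, MemLp.toLp_eq_toLp_iff]
        filter_upwards [w.laplacianFun_congr (Lp.coeFn_add f g)] with x hx
        rw [hx, w.laplacianFun_add (integrable_coe f) (integrable_coe g), Pi.add_apply]
      map_smul' := fun c f => by
        rw [RingHom.id_apply, ← MemLp.toLp_const_smul, MemLp.toLp_eq_toLp_iff]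
        filter_upwards [w.laplacianFun_congr (Lp.coeFn_smul c f)] with x hx
        rw [hx, w.laplacianFun_smul, Pi.smul_apply, smul_eq_mul] }
    2 w.norm_laplacian_le

theorem laplacian_ae_eq (w : Graphon) (f : L2) :
    w.laplacian f =ᵐ[volume] fun x => ∫ y, w x y * (f x - f y) :=
  (w.memLp_laplacianFun f).coeFn_toLp

/-- The intervals of the partition of `[0,1]` into `N` pieces, indexed from zero:
`[0, 1/N]` for `i = 0` and `(i/N, (i+1)/N]` for `i = 1, …, N - 1`. -/
def cell (N : ℕ) (i : Fin N) : Set unitInterval :=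
  {x | ((i : ℕ) = 0 ∨ ((i : ℕ) : ℝ) / N < x) ∧ (x : ℝ) ≤ (((i : ℕ) : ℝ) + 1) / N}

theorem measurableSet_cell (N : ℕ) (i : Fin N) : MeasurableSet (cell N i) := by
  refine MeasurableSet.inter ?_ (measurableSet_le measurable_subtype_coe measurable_const)
  exact (MeasurableSet.const _).union (measurableSet_lt measurable_const measurable_subtype_coe)

theorem cell_index_le {N : ℕ} {i j : Fin N} {x : unitInterval} (hi : x ∈ cell N i)
    (hj : x ∈ cell N j) : j ≤ i := by
  by_contra! h
  have hN : (0 : ℝ) < N := by exact_mod_cast Fin.pos i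
  have hlt : (i : ℕ) < (j : ℕ) := h
  rcases hj.1 with h0 | h1
  · omega
  · have h2 : ((j : ℕ) : ℝ) / N < (((i : ℕ) : ℝ) + 1) / N := h1.trans_le hi.2
    rw [div_lt_div_iff_of_pos_right hN] at h2
    have h3 : (j : ℕ) < (i : ℕ) + 1 := by exact_mod_cast h2
    omega

theorem sum_indicator_cell_le_one (N : ℕ) (x : unitInterval) :
    ∑ i : Fin N, (cell N i).indicator (1 : unitInterval → ℝ) x ≤ 1 := by
  by_cases h : ∃ i, x ∈ cell N i
  · obtain ⟨i, hi⟩ := h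
    rw [Finset.sum_eq_single i]
    · simp [hi]
    · intro j _ hj
      exact Set.indicator_of_notMem
        (fun hx => hj (le_antisymm (cell_index_le hi hx) (cell_index_le hx hi))) _
    · simp
  · push Not at h
    rw [Finset.sum_eq_zero fun i _ => Set.indicator_of_notMem (h i) _]
    exact zero_le_one

theorem indicator_cell_nonneg (N : ℕ) (i : Fin N) (x : unitInterval) :
    0 ≤ (cell N i).indicator (1 : unitInterval → ℝ) x :=
  Set.indicator_nonneg (fun _ _ => zero_le_one) x

/-- The step graphon `∑ᵢⱼ Aᵢⱼ 1_{Iᵢ}(x) 1_{Iⱼ}(y)` of a symmetric matrix with entries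
in `[0,1]`. -/
noncomputable def step {N : ℕ} (A : Matrix (Fin N) (Fin N) ℝ) (hs : ∀ i j, A i j = A j i)
    (h0 : ∀ i j, 0 ≤ A i j) (h1 : ∀ i j, A i j ≤ 1) : Graphon where
  toFun x y := ∑ i, ∑ j, A i j * (cell N i).indicator (1 : unitInterval → ℝ) x *
    (cell N j).indicator (1 : unitInterval → ℝ) y
  measurable' := by
    refine Finset.measurable_sum _ fun i _ => Finset.measurable_sum _ fun j _ => ?_
    exact (((measurable_const.indicator (measurableSet_cell N i)).comp measurable_fst).const_mul
      _).mul ((measurable_const.indicator (measurableSet_cell N j)).comp measurable_snd)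
  symm' x y := by
    rw [Finset.sum_comm]
    refine Finset.sum_congr rfl fun i _ => Finset.sum_congr rfl fun j _ => ?_
    rw [hs j i]
    ring
  nonneg' x y := Finset.sum_nonneg fun i _ => Finset.sum_nonneg fun j _ =>
    mul_nonneg (mul_nonneg (h0 i j) (indicator_cell_nonneg N i x)) (indicator_cell_nonneg N j y)
  le_one' x y := by
    have hx := indicator_cell_nonneg N (x := x)
    have hy := indicator_cell_nonneg N (x := y)
    calc _ ≤ ∑ i : Fin N, ∑ j : Fin N, (cell N i).indicator (1 : unitInterval → ℝ) x *
          (cell N j).indicator (1 : unitInterval → ℝ) y :=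
          Finset.sum_le_sum fun i _ => Finset.sum_le_sum fun j _ =>
            mul_le_mul_of_nonneg_right (mul_le_of_le_one_left (hx i) (h1 i j)) (hy j)
      _ = (∑ i : Fin N, (cell N i).indicator (1 : unitInterval → ℝ) x) *
          ∑ j : Fin N, (cell N j).indicator (1 : unitInterval → ℝ) y :=
          (Finset.sum_mul_sum _ _ _ _).symm
      _ ≤ 1 := mul_le_one₀ (sum_indicator_cell_le_one N x)
          (Finset.sum_nonneg fun j _ => hy j) (sum_indicator_cell_le_one N y)

/-- The position `(i+1)/N ∈ [0,1]` of the vertex with (zero-based) index `i`. -/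
noncomputable def vertex (N : ℕ) (i : Fin N) : unitInterval :=
  ⟨(((i : ℕ) : ℝ) + 1) / N, by positivity,
    div_le_one_of_le₀ (by exact_mod_cast i.isLt) (Nat.cast_nonneg N)⟩

/-- The model matrix `P_{ij} = w(i/N, j/N)`. -/
noncomputable def modelMatrix (w : Graphon) (N : ℕ) : Matrix (Fin N) (Fin N) ℝ :=
  fun i j => w (vertex N i) (vertex N j)

/-- The sampled graphon `w_N`. -/
noncomputable def sampled (w : Graphon) (N : ℕ) : Graphon :=
  step (w.modelMatrix N) (fun _ _ => w.symm' _ _) (fun _ _ => w.nonneg' _ _)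
    (fun _ _ => w.le_one' _ _)

open Classical in
/-- The step graphon of the adjacency matrix of a graph on `N` vertices. -/
noncomputable def ofGraph {N : ℕ} (H : SimpleGraph (Fin N)) : Graphon :=
  step (H.adjMatrix ℝ) (fun i j => by simp [SimpleGraph.adjMatrix_apply, H.adj_comm])
    (fun i j => by rw [SimpleGraph.adjMatrix_apply]; split_ifs <;> norm_num)
    (fun i j => by rw [SimpleGraph.adjMatrix_apply]; split_ifs <;> norm_num)

/-- `G ∼ ρ w`: the random simple graph `G` on `N` vertices has independent edges, and for
`i < j` the edge `ij` is present with probability `ρ w(i/N, j/N)`. -/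
structure IsSample (w : Graphon) (ρ : ℝ) {N : ℕ} {Ω : Type*} [MeasurableSpace Ω]
    (μ : Measure Ω) (G : Ω → SimpleGraph (Fin N)) : Prop where
  measurableSet_adj : ∀ i j : Fin N, i < j → MeasurableSet {ω | (G ω).Adj i j}
  prob_adj : ∀ i j : Fin N, i < j → μ.real {ω | (G ω).Adj i j} = ρ * w.modelMatrix N i j
  indep_adj : iIndepSet
    (fun e : {e : Fin N × Fin N // e.1 < e.2} => {ω | (G ω).Adj e.1.1 e.1.2}) μ

/-- The sparsity sequence `ρ_N = N^{-τ}`. -/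
noncomputable def sparsity (τ : ℝ) (N : ℕ) : ℝ := (N : ℝ) ^ (-τ)

/-- `ε_γ(N) = exp(-(log N)^γ)`. -/
noncomputable def epsGamma (γ : ℝ) (N : ℕ) : ℝ := Real.exp (-(Real.log N ^ γ))

/-- The positive integers `n` such that
`d_MAX ≥ 4 log(4N/ε(N)) / (9 ρ_N N) + 2K/N` for every `N ≥ n`. -/
def thresholds (w : Graphon) (K τ : ℝ) (ε : ℕ → ℝ) : Set ℕ :=
  {n | 1 ≤ n ∧ ∀ N : ℕ, n ≤ N →
    4 * Real.log (4 * N / ε N) / (9 * sparsity τ N * N) + 2 * K / N ≤ w.maxDegree}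

/-- The integer `N₁(w, τ, ε)`: the least threshold for the constant sequence `ε`. -/
noncomputable def N₁ (w : Graphon) (K τ ε : ℝ) : ℕ := sInf (w.thresholds K τ fun _ => ε)

/-- The integer `N₁'(w, τ, γ)`: the least threshold for the sequence `ε_γ(N)`. -/
noncomputable def N₁' (w : Graphon) (K τ γ : ℝ) : ℕ := sInf (w.thresholds K τ (epsGamma γ))

/-- The error bound `4 √(log(4N/ε) / (ρ_N N)) + 4K/N`. -/
noncomputable def errorBound (K τ ε : ℝ) (N : ℕ) : ℝ :=
  4 * Real.sqrt (Real.log (4 * N / ε) / (sparsity τ N * N)) + 4 * K / N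

end Graphon

/-! The error splits into `ρ_N⁻¹ 𝕃̂_N - 𝕃_N` and `𝕃_N - 𝕃`. The second term is deterministic: the
Lipschitz condition makes the kernels differ by at most `2K/N`, and passing to Laplacians costs a
factor 2.

For the first, a difference of step Laplacians acts on the fluctuation of `f` inside a cell as
multiplication by a normalized row sum, and on the cell averages as a matrix Laplacian. These
components are orthogonal, so the norm is a finite-dimensional quantity
(`norm_smul_step_laplacian_sub_le`). Both parts are controlled by the quadratic form of the centred
matrix Laplacian, up to its diagonal.

That Laplacian is `∑ 2 (1_e - q_e) p_e`, with `p_e` the projection onto the line of a difference of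
two basis vectors. A matrix Chernoff bound applies: Golden–Thompson removes one edge at a time, and
idempotence of `p_e` leaves only a scalar Bernoulli estimate. Subtracting `ρ y²` per edge keeps the
expected trace of the exponential at most `N`; undoing this costs a multiple of the complete-graph
Laplacian, whose form is at most `N ‖x‖²`. With `l = log(4N/ε)` and `y = ±√(l/(ρN))` the form is at
most `3 √(ρNl) ‖x‖²` outside probability `ε/2`; one more `√(ρNl)` absorbs the diagonal.

The threshold enters only through `d_MAX ≤ 1`: it forces `|y| ≤ 3/2`, the range where `exp y ≤ 1 + y
+ y²` is available. If `d_MAX = 0`, then `w = 0` and the graph is almost surely empty. -/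

section BanachAlgebra

/-! ### The Lie–Trotter product formula. -/

theorem norm_pow_sub_pow_le_of_norm_le {𝔸 : Type*} [NormedRing 𝔸] [NormOneClass 𝔸] {x y : 𝔸} {M : ℝ} (hM : 1 ≤ M)
    (hx : ‖x‖ ≤ M) (hy : ‖y‖ ≤ M) (n : ℕ) : ‖x ^ n - y ^ n‖ ≤ n * M ^ n * ‖x - y‖ := by
  have hM0 : 0 ≤ M := zero_le_one.trans hM
  induction n with
  | zero => simp
  | succ n ih =>
    have h : x ^ (n + 1) - y ^ (n + 1) = x ^ n * (x - y) + (x ^ n - y ^ n) * y := by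
      rw [pow_succ, pow_succ]; noncomm_ring
    have h1 : ‖x ^ n * (x - y)‖ ≤ M ^ (n + 1) * ‖x - y‖ := by
      refine (norm_mul_le _ _).trans (mul_le_mul_of_nonneg_right ?_ (norm_nonneg _))
      calc ‖x ^ n‖ ≤ ‖x‖ ^ n := norm_pow_le _ _
        _ ≤ M ^ n := pow_le_pow_left₀ (norm_nonneg _) hx n
        _ ≤ M ^ (n + 1) := pow_le_pow_right₀ hM n.le_succ
    have h2 : ‖(x ^ n - y ^ n) * y‖ ≤ (n * M ^ n * ‖x - y‖) * M :=
      (norm_mul_le _ _).trans (mul_le_mul ih hy (norm_nonneg _) (by positivity))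
    calc ‖x ^ (n + 1) - y ^ (n + 1)‖ ≤ _ := by rw [h]; exact norm_add_le _ _
      _ ≤ _ := add_le_add h1 h2
      _ = _ := by push_cast; ring

variable {𝔸 : Type*} [NormedRing 𝔸] [NormedAlgebra ℝ 𝔸]

theorem NormedSpace.norm_exp_le_exp_norm [NormOneClass 𝔸] [CompleteSpace 𝔸] (x : 𝔸) :
    ‖NormedSpace.exp x‖ ≤ Real.exp ‖x‖ := by
  rw [NormedSpace.exp_eq_tsum ℝ, Real.exp_eq_exp_ℝ, NormedSpace.exp_eq_tsum ℝ]
  refine tsum_of_norm_bounded (NormedSpace.expSeries_summable' (𝕂 := ℝ) ‖x‖).hasSum fun n => ?_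
  rw [norm_smul, norm_inv, Real.norm_natCast, smul_eq_mul]
  gcongr
  exact norm_pow_le x n

/-- The Lie–Trotter product formula. -/
theorem NormedSpace.tendsto_exp_mul_exp_pow [NormOneClass 𝔸] [CompleteSpace 𝔸] (a b : 𝔸) :
    Filter.Tendsto (fun n : ℕ => (NormedSpace.exp ((n : ℝ)⁻¹ • a) *
      NormedSpace.exp ((n : ℝ)⁻¹ • b)) ^ n) Filter.atTop (nhds (NormedSpace.exp (a + b))) := by
  set g : ℝ → 𝔸 := fun t => NormedSpace.exp (t • a) * NormedSpace.exp (t • b) -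
    NormedSpace.exp (t • (a + b)) with hg
  have hg0 : g 0 = 0 := by simp [hg]
  -- The two exponential curves agree to first order at 0, so `n ‖g (1/n)‖ → 0`; this beats the
  -- factor `n` lost in comparing `n`-th powers.
  have hd : HasDerivAt g 0 0 := by
    have h := ((hasDerivAt_exp_smul_const a (0 : ℝ)).mul
      (hasDerivAt_exp_smul_const b (0 : ℝ))).sub (hasDerivAt_exp_smul_const (a + b) (0 : ℝ))
    have h0 : NormedSpace.exp ((0 : ℝ) • a) * a * NormedSpace.exp ((0 : ℝ) • b) +
        NormedSpace.exp ((0 : ℝ) • a) * (NormedSpace.exp ((0 : ℝ) • b) * b) -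
        NormedSpace.exp ((0 : ℝ) • (a + b)) * (a + b) = 0 := by simp
    rw [h0] at h
    exact h
  have hlim : Filter.Tendsto (fun n : ℕ => (n : ℝ) * ‖g (n : ℝ)⁻¹‖) Filter.atTop (nhds 0) := by
    have h1 := (hasDerivAt_iff_tendsto_slope_zero.1 hd).norm
    have h2 : Filter.Tendsto (fun n : ℕ => (n : ℝ)⁻¹) Filter.atTop (nhdsWithin 0 {0}ᶜ) := by
      refine tendsto_nhdsWithin_iff.2 ⟨tendsto_inv_atTop_nhds_zero_nat, ?_⟩
      filter_upwards [Filter.eventually_ge_atTop 1] with n hn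
      have : (n : ℝ) ≠ 0 := by exact_mod_cast (by omega : n ≠ 0)
      simpa using this
    have h3 := h1.comp h2
    rw [norm_zero] at h3
    refine h3.congr fun n => ?_
    simp [hg0, norm_smul]
  rw [tendsto_iff_norm_sub_tendsto_zero]
  have hlim2 := hlim.const_mul (Real.exp (‖a‖ + ‖b‖))
  rw [mul_zero] at hlim2
  refine squeeze_zero' (Filter.Eventually.of_forall fun _ => norm_nonneg _) ?_ hlim2
  filter_upwards [Filter.eventually_ge_atTop 1] with n hn
  have hn0 : (n : ℝ) ≠ 0 := by exact_mod_cast (by omega : n ≠ 0)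
  have hpow : NormedSpace.exp (a + b) = NormedSpace.exp ((n : ℝ)⁻¹ • (a + b)) ^ n := by
    let : NormedAlgebra ℚ 𝔸 := NormedAlgebra.restrictScalars ℚ ℝ 𝔸
    rw [← NormedSpace.exp_nsmul, ← Nat.cast_smul_eq_nsmul ℝ, smul_smul, mul_inv_cancel₀ hn0,
      one_smul]
  have hnn : 0 ≤ (n : ℝ)⁻¹ := by positivity
  set M := Real.exp ((n : ℝ)⁻¹ * (‖a‖ + ‖b‖)) with hM
  have hM1 : 1 ≤ M := Real.one_le_exp (by positivity)
  have hnorm : ∀ c : 𝔸, ‖NormedSpace.exp ((n : ℝ)⁻¹ • c)‖ ≤ Real.exp ((n : ℝ)⁻¹ * ‖c‖) :=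
    fun c => (NormedSpace.norm_exp_le_exp_norm _).trans_eq (by
      rw [norm_smul, Real.norm_of_nonneg hnn])
  have hX : ‖NormedSpace.exp ((n : ℝ)⁻¹ • a) * NormedSpace.exp ((n : ℝ)⁻¹ • b)‖ ≤ M := by
    refine (norm_mul_le _ _).trans ?_
    rw [hM, mul_add, Real.exp_add]
    exact mul_le_mul (hnorm a) (hnorm b) (norm_nonneg _) (Real.exp_pos _).le
  have hY : ‖NormedSpace.exp ((n : ℝ)⁻¹ • (a + b))‖ ≤ M :=
    (hnorm _).trans (Real.exp_le_exp.2 (mul_le_mul_of_nonneg_left (norm_add_le _ _) hnn))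
  have hMn : M ^ n = Real.exp (‖a‖ + ‖b‖) := by
    rw [hM, ← Real.exp_nat_mul, ← mul_assoc, mul_inv_cancel₀ hn0, one_mul]
  rw [hpow]
  refine (norm_pow_sub_pow_le_of_norm_le hM1 hX hY n).trans_eq ?_
  rw [hMn, hg]
  ring

end BanachAlgebra

namespace Matrix

variable {n : Type*} [Fintype n] [DecidableEq n]

theorem tendsto_exp_mul_exp_pow (A B : Matrix n n ℝ) :
    Filter.Tendsto (fun k : ℕ => (NormedSpace.exp ((k : ℝ)⁻¹ • A) *
      NormedSpace.exp ((k : ℝ)⁻¹ • B)) ^ k) Filter.atTop (nhds (NormedSpace.exp (A + B))) := by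
  -- `NormOneClass` fails for the zero ring of empty matrices.
  cases isEmpty_or_nonempty n
  · simp only [Subsingleton.elim _ (0 : Matrix n n ℝ)]
    exact tendsto_const_nhds
  · open scoped Norms.Operator in exact NormedSpace.tendsto_exp_mul_exp_pow A B

end Matrix

/-! ### The Golden–Thompson inequality by dyadic trace inequalities. -/

namespace Matrix

variable {n : Type*} [Fintype n]

theorem trace_mul_transpose_self_nonneg (X : Matrix n n ℝ) : 0 ≤ (X * Xᵀ).trace := by
  simp only [trace, diag_apply, mul_apply, transpose_apply]
  exact Finset.sum_nonneg fun i _ => Finset.sum_nonneg fun j _ => mul_self_nonneg _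

theorem trace_mul_self_le (X : Matrix n n ℝ) : (X * X).trace ≤ (X * Xᵀ).trace := by
  have h := trace_mul_transpose_self_nonneg (X - Xᵀ)
  have h1 : (Xᵀ * Xᵀ).trace = (X * X).trace := by rw [← transpose_mul, trace_transpose]
  have h2 : (Xᵀ * X).trace = (X * Xᵀ).trace := trace_mul_comm _ _
  simp only [transpose_sub, transpose_transpose, sub_mul, mul_sub, trace_sub, h1, h2] at h
  linarith

theorem IsSymm.two_mul_trace_mul_le {R S : Matrix n n ℝ} (hR : R.IsSymm) (hS : S.IsSymm) :
    2 * (R * S).trace ≤ (R * R).trace + (S * S).trace := by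
  have h := trace_mul_transpose_self_nonneg (R - S)
  rw [transpose_sub, hR, hS] at h
  simp only [sub_mul, mul_sub, trace_sub, trace_mul_comm S R] at h
  linarith

variable [DecidableEq n]

theorem trace_mul_pow_comm (A B : Matrix n n ℝ) (m : ℕ) :
    ((A * B) ^ m).trace = ((B * A) ^ m).trace := by
  cases m with
  | zero => simp
  | succ m =>
    have h : SemiconjBy A (B * A) (A * B) := (mul_assoc A B A).symm
    rw [pow_succ, ← mul_assoc, ← (h.pow_right m).eq, mul_assoc, trace_mul_comm, pow_succ, mul_assoc]

/-- The two statements feed each other in the induction. The first, applied to `X * X`, produces `(X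
Xᵀ)(Xᵀ X)` up to cyclicity, which the second and then `2 tr RS ≤ tr R² + tr S²` handle. The second
follows by applying the first to `R * S` and then itself to the squares. -/
theorem trace_pow_two_pow_le (k : ℕ) :
    (∀ X : Matrix n n ℝ, (X ^ 2 ^ (k + 1)).trace ≤ ((X * Xᵀ) ^ 2 ^ k).trace) ∧
    ∀ R S : Matrix n n ℝ, R.IsSymm → S.IsSymm →
      ((R * S) ^ 2 ^ k).trace ≤ (R ^ 2 ^ k * S ^ 2 ^ k).trace := by
  induction k with
  | zero => exact ⟨fun X => by simpa [pow_two] using trace_mul_self_le X, fun R S _ _ => by simp⟩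
  | succ k ih =>
    refine ⟨fun X => ?_, fun R S hR hS => ?_⟩
    · have hR : (Xᵀ * X).IsSymm := by simp [IsSymm]
      have hS : (X * Xᵀ).IsSymm := by simp [IsSymm]
      have h1 := ih.1 (X * X)
      have h2 : (X * X) * (X * X)ᵀ = X * ((X * Xᵀ) * Xᵀ) := by
        rw [transpose_mul]; noncomm_ring
      have h3 : (X * Xᵀ) * Xᵀ * X = (X * Xᵀ) * (Xᵀ * X) := by noncomm_ring
      rw [h2, trace_mul_pow_comm X (X * Xᵀ * Xᵀ), h3, ← pow_two, ← pow_mul, ← pow_succ'] at h1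
      have h4 := ih.2 _ _ hS hR
      have h5 := (hS.pow (2 ^ k)).two_mul_trace_mul_le (hR.pow (2 ^ k))
      rw [← pow_two, ← pow_two, ← pow_mul, ← pow_mul, ← pow_succ, trace_mul_pow_comm Xᵀ X] at h5
      linarith
    · have h1 := ih.1 (R * S)
      have h2 : (R * S) * (R * S)ᵀ = R * (S ^ 2 * R) := by
        rw [transpose_mul, hR, hS, pow_two]; noncomm_ring
      have h3 : S ^ 2 * R * R = S ^ 2 * R ^ 2 := by rw [pow_two R, mul_assoc]
      rw [h2, trace_mul_pow_comm R (S ^ 2 * R), h3] at h1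
      have h4 := ih.2 _ _ (hS.pow 2) (hR.pow 2)
      rw [← pow_mul, ← pow_mul, ← pow_succ', trace_mul_comm] at h4
      exact h1.trans h4

/-- The Golden–Thompson inequality for real symmetric matrices. -/
theorem IsSymm.trace_exp_add_le {A B : Matrix n n ℝ} (hA : A.IsSymm) (hB : B.IsSymm) :
    (NormedSpace.exp (A + B)).trace ≤ (NormedSpace.exp A * NormedSpace.exp B).trace := by
  -- The trace inequality is available only for exponents `2 ^ k`, so the Lie–Trotter limit is taken
  -- along that subsequence.
  have h1 := (tendsto_exp_mul_exp_pow A B).comp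
    (tendsto_pow_atTop_atTop_of_one_lt (one_lt_two : 1 < 2))
  have h2 := ((continuous_id.matrix_trace).tendsto (NormedSpace.exp (A + B))).comp h1
  refine le_of_tendsto h2 (Filter.Eventually.of_forall fun k => ?_)
  have hp : ∀ C : Matrix n n ℝ,
      NormedSpace.exp (((2 ^ k : ℕ) : ℝ)⁻¹ • C) ^ 2 ^ k = NormedSpace.exp C := fun C => by
    rw [← Matrix.exp_nsmul, ← Nat.cast_smul_eq_nsmul ℝ, smul_smul, mul_inv_cancel₀ (by positivity),
      one_smul]
  have h := (trace_pow_two_pow_le k).2 _ _ (hA.smul ((2 ^ k : ℕ) : ℝ)⁻¹).exp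
    (hB.smul ((2 ^ k : ℕ) : ℝ)⁻¹).exp
  rwa [hp, hp] at h

/-! ### Exponential moments of independent combinations of projections. -/

theorem exp_smul_of_isIdempotentElem {p : Matrix n n ℝ} (hp : IsIdempotentElem p) (a : ℝ) :
    NormedSpace.exp (a • p) = 1 + (Real.exp a - 1) • p := by
  have h1 : HasSum (fun k : ℕ => ((k.factorial : ℝ)⁻¹) • (a • p) ^ k)
      ((Real.exp a) • p + (1 - p)) := by
    have h2 : HasSum (fun k : ℕ => ((k.factorial : ℝ)⁻¹ * a ^ k) • p) (Real.exp a • p) := by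
      rw [Real.exp_eq_exp_ℝ]
      refine HasSum.smul_const ?_ p
      simpa using NormedSpace.exp_series_hasSum_exp' (𝕂 := ℝ) a
    refine (h2.add (hasSum_ite_eq 0 (1 - p))).congr_fun fun k => ?_
    cases k with
    | zero => simp
    | succ k => simp [smul_pow, hp.pow_succ_eq, smul_smul]
  rw [NormedSpace.exp_eq_tsum ℝ]
  refine (h1.tsum_eq).trans ?_
  rw [sub_smul, one_smul]; abel

/-- With `E = exp (Z/2)`, the trace equals that of `(E p)(E p)ᵀ`. -/
theorem IsSymm.trace_exp_mul_nonneg {Z p : Matrix n n ℝ} (hZ : Z.IsSymm) (hs : p.IsSymm)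
    (hp : IsIdempotentElem p) : 0 ≤ (NormedSpace.exp Z * p).trace := by
  have h1 : NormedSpace.exp Z = NormedSpace.exp ((2 : ℝ)⁻¹ • Z) * NormedSpace.exp ((2 : ℝ)⁻¹ • Z) := by
    rw [← pow_two, ← Matrix.exp_nsmul, ← Nat.cast_smul_eq_nsmul ℝ, smul_smul]; norm_num
  have h2 : (NormedSpace.exp ((2 : ℝ)⁻¹ • Z)).IsSymm := (hZ.smul _).exp
  set E := NormedSpace.exp ((2 : ℝ)⁻¹ • Z)
  have h3 := trace_mul_transpose_self_nonneg (E * p)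
  rw [transpose_mul, hs, h2, mul_assoc, ← mul_assoc p p, hp.eq, ← mul_assoc, trace_mul_comm,
    ← mul_assoc] at h3
  rwa [h1]

/-- Golden–Thompson bounds `tr exp (Z + c p)` by a function affine in `exp c`, with nonnegative
slope `tr (exp Z * p)`. Averaging over `c = a, b` thus needs only the scalar moment. -/
theorem IsSymm.two_point_trace_exp_le {Z p : Matrix n n ℝ} (hZ : Z.IsSymm) (hs : p.IsSymm)
    (hp : IsIdempotentElem p) {q a b : ℝ} (hq0 : 0 ≤ q) (hq1 : q ≤ 1)
    (hq : q * Real.exp a + (1 - q) * Real.exp b ≤ 1) :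
    q * (NormedSpace.exp (Z + a • p)).trace + (1 - q) * (NormedSpace.exp (Z + b • p)).trace ≤
      (NormedSpace.exp Z).trace := by
  have h : ∀ c : ℝ, (NormedSpace.exp (Z + c • p)).trace ≤
      (NormedSpace.exp Z).trace + (Real.exp c - 1) * (NormedSpace.exp Z * p).trace := fun c => by
    refine (hZ.trace_exp_add_le (hs.smul c)).trans_eq ?_
    rw [exp_smul_of_isIdempotentElem hp, mul_add, mul_one, trace_add, mul_smul_comm, trace_smul,
      smul_eq_mul]
  have h0 := hZ.trace_exp_mul_nonneg hs hp
  have ha := mul_le_mul_of_nonneg_left (h a) hq0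
  have hb := mul_le_mul_of_nonneg_left (h b) (sub_nonneg.2 hq1)
  nlinarith [mul_nonneg (sub_nonneg.2 hq) h0]

/-- The left side is an expectation over independent two-valued coefficients. Each induction step
absorbs one of them into `Z`, hence the quantification over all symmetric `Z`. -/
theorem sum_powerset_trace_exp_le {ι : Type*} [DecidableEq ι] {p : ι → Matrix n n ℝ}
    (hs : ∀ i, (p i).IsSymm) (hp : ∀ i, IsIdempotentElem (p i)) {q a b : ι → ℝ}
    (hq0 : ∀ i, 0 ≤ q i) (hq1 : ∀ i, q i ≤ 1)
    (hq : ∀ i, q i * Real.exp (a i) + (1 - q i) * Real.exp (b i) ≤ 1) (S : Finset ι) :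
    ∀ {Z : Matrix n n ℝ}, Z.IsSymm →
    ∑ T ∈ S.powerset, (∏ i ∈ S, if i ∈ T then q i else 1 - q i) *
      (NormedSpace.exp (Z + ∑ i ∈ S, (if i ∈ T then a i else b i) • p i)).trace ≤
        (NormedSpace.exp Z).trace := by
  induction S using Finset.induction_on with
  | empty => intro Z _; simp
  | insert e S he ih =>
    intro Z hZ
    have hne : ∀ i ∈ S, i ≠ e := fun i hi h => he (h ▸ hi)
    have hmem : ∀ T : Finset ι, ∀ i ∈ S, (i ∈ insert e T ↔ i ∈ T) := fun T i hi => by simp [hne i hi]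
    rw [Finset.sum_powerset_insert he]
    have h1 : ∑ T ∈ S.powerset, (∏ i ∈ insert e S, if i ∈ T then q i else 1 - q i) *
        (NormedSpace.exp (Z + ∑ i ∈ insert e S, (if i ∈ T then a i else b i) • p i)).trace ≤
        (1 - q e) * (NormedSpace.exp (Z + b e • p e)).trace := by
      refine le_trans (le_of_eq ?_) (mul_le_mul_of_nonneg_left (ih (hZ.add ((hs e).smul (b e))))
        (sub_nonneg.2 (hq1 e)))
      rw [Finset.mul_sum]
      refine Finset.sum_congr rfl fun T hT => ?_
      have heT : e ∉ T := fun h => he (Finset.mem_powerset.1 hT h)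
      rw [Finset.prod_insert he, Finset.sum_insert he, if_neg heT, if_neg heT, mul_assoc, add_assoc]
    have h2 : ∑ T ∈ S.powerset,
        (∏ i ∈ insert e S, if i ∈ insert e T then q i else 1 - q i) *
        (NormedSpace.exp (Z + ∑ i ∈ insert e S,
          (if i ∈ insert e T then a i else b i) • p i)).trace ≤
        q e * (NormedSpace.exp (Z + a e • p e)).trace := by
      refine le_trans (le_of_eq ?_) (mul_le_mul_of_nonneg_left (ih (hZ.add ((hs e).smul (a e))))
        (hq0 e))
      rw [Finset.mul_sum]
      refine Finset.sum_congr rfl fun T hT => ?_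
      rw [Finset.prod_insert he, Finset.sum_insert he, if_pos (Finset.mem_insert_self _ _),
        if_pos (Finset.mem_insert_self _ _), mul_assoc, add_assoc,
        Finset.prod_congr rfl fun i hi => if_congr (hmem T i hi) rfl rfl,
        Finset.sum_congr rfl fun i hi => congrArg (· • p i) (if_congr (hmem T i hi) rfl rfl)]
    have h3 := hZ.two_point_trace_exp_le (hs e) (hp e) (hq0 e) (hq1 e) (hq e)
    linarith

/-- Each `exp (l i)` is at most their sum `tr exp H`, so every eigenvalue is at most `s`. -/
theorem IsSymm.dotProduct_mulVec_le_of_trace_exp_le {H : Matrix n n ℝ} (hH : H.IsSymm) {s : ℝ}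
    (hs : (NormedSpace.exp H).trace ≤ Real.exp s) (x : n → ℝ) :
    x ⬝ᵥ H *ᵥ x ≤ s * (x ⬝ᵥ x) := by
  have hH' : H.IsHermitian := by rw [IsHermitian, conjTranspose_eq_transpose_of_trivial]; exact hH
  set U : Matrix n n ℝ := hH'.eigenvectorUnitary.1 with hU
  set l := hH'.eigenvalues with hl
  have hUU : U * Uᵀ = 1 := by
    have := Unitary.coe_mul_star_self hH'.eigenvectorUnitary
    rwa [Unitary.coe_star, star_eq_conjTranspose, conjTranspose_eq_transpose_of_trivial] at this
  have hinv : U⁻¹ = Uᵀ := inv_eq_right_inv hUU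
  have hunit : IsUnit U := IsUnit.of_mul_eq_one _ hUU
  have hspec : H = U * diagonal l * U⁻¹ := by
    have := hH'.spectral_theorem
    rw [Unitary.conjStarAlgAut_apply, star_eq_conjTranspose,
      conjTranspose_eq_transpose_of_trivial] at this
    rw [hinv]
    exact this
  have htr : (NormedSpace.exp H).trace = ∑ i, Real.exp (l i) := by
    rw [hspec, exp_conj _ _ hunit, trace_mul_comm, ← mul_assoc, hinv,
      mul_eq_one_comm.1 hUU, one_mul, exp_diagonal, trace_diagonal]
    simp [Pi.coe_exp, Real.exp_eq_exp_ℝ]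
  have hle : ∀ i, l i ≤ s := fun i => by
    rw [← Real.exp_le_exp]
    refine le_trans ?_ hs
    rw [htr]
    exact Finset.single_le_sum (f := fun i => Real.exp (l i)) (fun _ _ => (Real.exp_pos _).le)
      (Finset.mem_univ i)
  set y := Uᵀ *ᵥ x with hy
  have hx : x = U *ᵥ y := by rw [hy, mulVec_mulVec, hUU, one_mulVec]
  have h1 : x ⬝ᵥ H *ᵥ x = ∑ i, l i * (y i * y i) := by
    rw [hspec, hinv, ← mulVec_mulVec, ← mulVec_mulVec, ← hy, dotProduct_mulVec, ← mulVec_transpose,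
      ← hy]
    simp only [dotProduct, mulVec_diagonal]
    exact Finset.sum_congr rfl fun i _ => by ring
  have h2 : x ⬝ᵥ x = ∑ i, y i * y i := by
    conv_lhs => rw [hx, dotProduct_mulVec, ← mulVec_transpose, mulVec_mulVec,
      mul_eq_one_comm.1 hUU, one_mulVec]
    rfl
  rw [h1, h2, Finset.mul_sum]
  exact Finset.sum_le_sum fun i _ => mul_le_mul_of_nonneg_right (hle i) (mul_self_nonneg _)

end Matrix

/-! ### Scalar estimates for a centred Bernoulli variable. -/

theorem Real.exp_le_one_add_add_sq {y : ℝ} (hy : y ≤ 3 / 2) : Real.exp y ≤ 1 + y + y ^ 2 := by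
  rcases le_total y (-1) with h | h
  · have : Real.exp y ≤ 1 := Real.exp_le_one_iff.2 (by linarith)
    nlinarith
  rcases le_total y 1 with h1 | h1
  · have := (abs_le.1 (Real.abs_exp_sub_one_sub_id_le (abs_le.2 ⟨h, h1⟩))).2
    linarith
  · obtain ⟨z, rfl⟩ : ∃ z, y = 2 * z := ⟨y / 2, by ring⟩
    have hz0 : 1 / 2 ≤ z := by linarith
    have hz1 : z ≤ 3 / 4 := by linarith
    -- The right side is the chord over `[1/2, 3/4]` of the convex cubic `1 + z + z²/2 + 2z³/9`, the
    -- bound given by `Real.exp_bound'`.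
    have hz : Real.exp z ≤ 17 / 8 - 17 / 9 * (3 / 4 - z) := by
      have hb := Real.exp_bound' (x := z) (by linarith) (by linarith) (n := 3) (by norm_num)
      norm_num [Finset.sum_range_succ, Nat.factorial] at hb
      have h2 : (z - 1 / 2) * (3 / 4 - z) ≥ 0 :=
        mul_nonneg (by linarith) (by linarith)
      nlinarith [mul_nonneg h2 (by linarith : 0 ≤ z)]
    have h0 : 0 ≤ Real.exp z := (Real.exp_pos z).le
    rw [two_mul, Real.exp_add]
    nlinarith [mul_le_mul hz hz h0 (by linarith)]

theorem bernoulli_mgf_le {q ρ y : ℝ} (hq0 : 0 ≤ q) (hq : q ≤ ρ) (hy : y ≤ 3 / 2) :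
    q * Real.exp (y * (1 - q) - ρ * y ^ 2) + (1 - q) * Real.exp (y * (-q) - ρ * y ^ 2) ≤ 1 := by
  have h1 : q * Real.exp (y * (1 - q) - ρ * y ^ 2) + (1 - q) * Real.exp (y * (-q) - ρ * y ^ 2) =
      Real.exp (-(y * q) - ρ * y ^ 2) * (q * (Real.exp y - 1) + 1) := by
    rw [show y * (1 - q) - ρ * y ^ 2 = (-(y * q) - ρ * y ^ 2) + y by ring, Real.exp_add,
      show y * (-q) - ρ * y ^ 2 = -(y * q) - ρ * y ^ 2 by ring]
    ring
  rw [h1]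
  calc _ ≤ Real.exp (-(y * q) - ρ * y ^ 2) * Real.exp (q * (Real.exp y - 1)) :=
        mul_le_mul_of_nonneg_left (Real.add_one_le_exp _) (Real.exp_pos _).le
    _ = Real.exp (-(y * q) - ρ * y ^ 2 + q * (Real.exp y - 1)) := (Real.exp_add _ _).symm
    _ ≤ 1 := by
      rw [Real.exp_le_one_iff]
      nlinarith [mul_le_mul_of_nonneg_left (Real.exp_le_one_add_add_sq hy) hq0,
        mul_le_mul_of_nonneg_right hq (sq_nonneg y)]

/-- The pairs `i < j` of vertices of a graph on `Fin N`. -/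
abbrev OrderedPair (N : ℕ) : Type := {e : Fin N × Fin N // e.1 < e.2}

/-! ### Finite Laplacians as sums over edges, and the matrix Chernoff bound. -/

namespace OrderedPair

variable {N : ℕ}

theorem sum_sum_eq {F : Fin N → Fin N → ℝ} (hF : ∀ i, F i i = 0) :
    ∑ i, ∑ j, F i j = ∑ e : OrderedPair N, (F e.1.1 e.1.2 + F e.1.2 e.1.1) := by
  have h1 : ∀ i j, F i j = (if i < j then F i j else 0) + (if j < i then F i j else 0) := by
    intro i j
    rcases lt_trichotomy i j with h | rfl | h
    · simp [h, h.not_gt]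
    · simp [hF]
    · simp [h, h.not_gt]
  have h2 : ∑ i, ∑ j, F i j = ∑ i, ∑ j, (if i < j then F i j + F j i else 0) := by
    rw [Finset.sum_congr rfl fun i _ => Finset.sum_congr rfl fun j _ => h1 i j]
    simp_rw [Finset.sum_add_distrib]
    rw [Finset.sum_comm (f := fun i j => if j < i then F i j else 0)]
    simp_rw [← Finset.sum_add_distrib]
    refine Finset.sum_congr rfl fun i _ => Finset.sum_congr rfl fun j _ => ?_
    split_ifs <;> simp
  rw [h2, ← Fintype.sum_prod_type' (f := fun i j => if i < j then F i j + F j i else 0),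
    ← Finset.sum_filter]
  exact Finset.sum_subtype _ (by simp) _

theorem laplacian_bilinForm {u : Fin N → Fin N → ℝ} (hu : ∀ i j, u i j = u j i)
    (x y : Fin N → ℝ) :
    ∑ i, y i * ∑ j, u i j * (x i - x j) =
      ∑ e : OrderedPair N, u e.1.1 e.1.2 * ((x e.1.1 - x e.1.2) * (y e.1.1 - y e.1.2)) := by
  simp_rw [Finset.mul_sum]
  rw [sum_sum_eq fun i => by ring]
  refine Finset.sum_congr rfl fun e _ => ?_
  rw [hu e.1.2 e.1.1]
  ring

theorem laplacian_quadForm {u : Fin N → Fin N → ℝ} (hu : ∀ i j, u i j = u j i) (x : Fin N → ℝ) :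
    ∑ i, x i * ∑ j, u i j * (x i - x j) =
      ∑ e : OrderedPair N, u e.1.1 e.1.2 * (x e.1.1 - x e.1.2) ^ 2 := by
  simp_rw [laplacian_bilinForm hu, pow_two]

/-- For a symmetric operator a bound on the quadratic form bounds the norm, by polarization between
`x` and `y`. -/
theorem sum_sq_laplacian_le {u : Fin N → Fin N → ℝ} (hu : ∀ i j, u i j = u j i) {t : ℝ}
    (ht : 0 < t) (h : ∀ x : Fin N → ℝ, |∑ i, x i * ∑ j, u i j * (x i - x j)| ≤ t * ∑ i, x i ^ 2)
    (x : Fin N → ℝ) : ∑ i, (∑ j, u i j * (x i - x j)) ^ 2 ≤ t ^ 2 * ∑ i, x i ^ 2 := by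
  set m : Fin N → ℝ := fun i => ∑ j, u i j * (x i - x j) with hm
  -- This scaling makes `t ‖y‖²` and `⟨y, m⟩` both equal to `‖m‖² / t`.
  set y : Fin N → ℝ := fun i => m i / t with hy
  have h1 := (abs_le.1 (h (x + y))).2
  have h2 := (abs_le.1 (h (x - y))).1
  rw [laplacian_quadForm hu] at h1 h2
  have h3 : ∑ i, y i * m i = ∑ e : OrderedPair N,
      u e.1.1 e.1.2 * ((x e.1.1 - x e.1.2) * (y e.1.1 - y e.1.2)) := laplacian_bilinForm hu x y
  have h4 : ∑ e : OrderedPair N, u e.1.1 e.1.2 * ((x + y) e.1.1 - (x + y) e.1.2) ^ 2 -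
      ∑ e : OrderedPair N, u e.1.1 e.1.2 * ((x - y) e.1.1 - (x - y) e.1.2) ^ 2 =
      4 * ∑ i, y i * m i := by
    rw [h3, ← Finset.sum_sub_distrib, Finset.mul_sum]
    refine Finset.sum_congr rfl fun e _ => ?_
    simp only [Pi.add_apply, Pi.sub_apply]
    ring
  have h5 : ∑ i, (x + y) i ^ 2 + ∑ i, (x - y) i ^ 2 = 2 * (∑ i, x i ^ 2 + ∑ i, y i ^ 2) := by
    rw [← Finset.sum_add_distrib, ← Finset.sum_add_distrib, Finset.mul_sum]
    refine Finset.sum_congr rfl fun e _ => ?_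
    simp only [Pi.add_apply, Pi.sub_apply]
    ring
  have h6 : ∑ i, y i * m i = (∑ i, m i ^ 2) / t := by
    rw [Finset.sum_div]
    exact Finset.sum_congr rfl fun i _ => by simp only [hy]; ring
  have h7 : t * ∑ i, y i ^ 2 = (∑ i, m i ^ 2) / t := by
    rw [Finset.mul_sum, Finset.sum_div]
    exact Finset.sum_congr rfl fun i _ => by simp only [hy]; field_simp
  have h8 : (∑ i, m i ^ 2) / t ≤ t * ∑ i, x i ^ 2 := by
    linear_combination (h1 + h2 - h4 + t * h5 - 4 * h6 + 2 * h7) / 2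
  rw [div_le_iff₀ ht] at h8
  linarith

/-- Testing on a basis vector sees the row sum without its diagonal entry, which is added back. -/
theorem abs_row_sum_le {u : Fin N → Fin N → ℝ} {t : ℝ}
    (h : ∀ x : Fin N → ℝ, |∑ i, x i * ∑ j, u i j * (x i - x j)| ≤ t * ∑ i, x i ^ 2) (k : Fin N) :
    |∑ j, u k j| ≤ t + |u k k| := by
  have h1 := h (Pi.single k 1)
  have h2 : ∑ i, (Pi.single k 1 : Fin N → ℝ) i *
      ∑ j, u i j * ((Pi.single k 1 : Fin N → ℝ) i - (Pi.single k 1 : Fin N → ℝ) j) =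
      ∑ j, u k j - u k k := by
    rw [Finset.sum_eq_single k (fun i _ hi => by simp [hi]) (by simp)]
    simp [mul_sub, Finset.sum_sub_distrib, Pi.single_apply]
  have h3 : ∑ i, (Pi.single k 1 : Fin N → ℝ) i ^ 2 = 1 := by
    simp [Pi.single_apply]
  rw [h2, h3, mul_one] at h1
  have := abs_add_le (∑ j, u k j - u k k) (u k k)
  rw [sub_add_cancel] at this
  linarith

theorem sum_sq_sub_le (x : Fin N → ℝ) :
    ∑ e : OrderedPair N, (x e.1.1 - x e.1.2) ^ 2 ≤ N * ∑ i, x i ^ 2 := by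
  have h := laplacian_quadForm (u := fun _ _ => 1) (fun _ _ => rfl) x
  simp only [one_mul] at h
  rw [← h]
  simp only [Finset.sum_sub_distrib, Finset.sum_const, Finset.card_univ, Fintype.card_fin,
    nsmul_eq_mul, mul_sub, ← Finset.sum_mul]
  have : ∀ i, x i * (N * x i) = N * x i ^ 2 := fun i => by ring
  simp_rw [this, ← Finset.mul_sum]
  nlinarith [mul_self_nonneg (∑ i, x i)]

/-- The orthogonal projection onto the line spanned by the difference of two basis vectors. -/
noncomputable def proj (e : OrderedPair N) : Matrix (Fin N) (Fin N) ℝ :=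
  (2 : ℝ)⁻¹ • Matrix.vecMulVec (Pi.single e.1.1 1 - Pi.single e.1.2 1)
    (Pi.single e.1.1 1 - Pi.single e.1.2 1)

theorem proj_isSymm (e : OrderedPair N) : (proj e).IsSymm := by
  rw [Matrix.IsSymm, proj, Matrix.transpose_smul, Matrix.transpose_vecMulVec]

theorem proj_isIdempotentElem (e : OrderedPair N) : IsIdempotentElem (proj e) := by
  have h1 : e.1.1 ≠ e.1.2 := e.2.ne
  rw [IsIdempotentElem, proj, smul_mul_smul_comm, Matrix.vecMulVec_mul_vecMulVec]
  have h2 : (Pi.single e.1.1 1 - Pi.single e.1.2 1 : Fin N → ℝ) ⬝ᵥ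
      (Pi.single e.1.1 1 - Pi.single e.1.2 1) = 2 := by
    simp [h1, h1.symm]; norm_num
  rw [h2, Matrix.vecMulVec_smul, smul_smul]
  norm_num

theorem proj_quadForm (e : OrderedPair N) (x : Fin N → ℝ) :
    x ⬝ᵥ (proj e).mulVec x = (x e.1.1 - x e.1.2) ^ 2 / 2 := by
  rw [proj, Matrix.smul_mulVec, Matrix.vecMulVec_mulVec]
  simp [dotProduct_sub, sub_dotProduct]
  ring

theorem sum_proj_quadForm (c : OrderedPair N → ℝ) (x : Fin N → ℝ) :
    x ⬝ᵥ (∑ e, c e • proj e).mulVec x = (∑ e, c e * (x e.1.1 - x e.1.2) ^ 2) / 2 := by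
  rw [Matrix.sum_mulVec, dotProduct_sum, Finset.sum_div]
  refine Finset.sum_congr rfl fun e _ => ?_
  rw [Matrix.smul_mulVec, dotProduct_smul, proj_quadForm, smul_eq_mul]
  ring

/-- The probability that independent edges with probabilities `q` form exactly the set `T`. -/
noncomputable def weight (q : OrderedPair N → ℝ) (T : Finset (OrderedPair N)) : ℝ :=
  ∏ e, if e ∈ T then q e else 1 - q e

/-- Markov's inequality for `tr exp H`, whose expectation is at most `tr exp 0 = N`. The factor in
`2 * r` comes from the `1/2` that normalizes `proj`; the term `ρ y² N` pays for the compensator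
through `sum_sq_sub_le`. -/
theorem sum_weight_filter_le {q : OrderedPair N → ℝ} {ρ y r : ℝ} (hq0 : ∀ e, 0 ≤ q e)
    (hqρ : ∀ e, q e ≤ ρ) (hq1 : ∀ e, q e ≤ 1) (hρ : 0 ≤ ρ) (hy : y ≤ 3 / 2)
    {Q : Finset (OrderedPair N) → Prop} [DecidablePred Q]
    (hQ : ∀ T, Q T → ∃ x : Fin N → ℝ, (2 * r + ρ * y ^ 2 * N) * ∑ i, x i ^ 2 <
      y * ∑ e, ((if e ∈ T then 1 else 0) - q e) * (x e.1.1 - x e.1.2) ^ 2) :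
    ∑ T : Finset (OrderedPair N) with Q T, weight q T ≤ N * Real.exp (-r) := by
  set a : OrderedPair N → ℝ := fun e => y * (1 - q e) - ρ * y ^ 2 with ha
  set b : OrderedPair N → ℝ := fun e => y * (-q e) - ρ * y ^ 2 with hb
  set H : Finset (OrderedPair N) → Matrix (Fin N) (Fin N) ℝ :=
    fun T => ∑ e, (if e ∈ T then a e else b e) • proj e with hH
  have hHs : ∀ T, (H T).IsSymm := fun T => by
    simp only [hH, Matrix.IsSymm, Matrix.transpose_sum, Matrix.transpose_smul]
    exact Finset.sum_congr rfl fun e _ => by rw [(proj_isSymm e).eq]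
  have h1 : ∑ T, weight q T * (NormedSpace.exp (H T)).trace ≤ N := by
    have := Matrix.sum_powerset_trace_exp_le (a := a) (b := b) proj_isSymm proj_isIdempotentElem
      hq0 hq1 (fun e => bernoulli_mgf_le (hq0 e) (hqρ e) hy) Finset.univ
      (Z := 0) Matrix.isSymm_zero
    simpa [weight, hH] using this
  have hw : ∀ T, 0 ≤ weight q T := fun T => Finset.prod_nonneg fun e _ => by
    split_ifs
    · exact hq0 e
    · exact sub_nonneg.2 (hq1 e)
  have htr : ∀ T, 0 ≤ (NormedSpace.exp (H T)).trace := fun T => by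
    simpa using (hHs T).trace_exp_mul_nonneg Matrix.isSymm_one IsIdempotentElem.one
  have h2 : ∀ T, Q T → Real.exp r ≤ (NormedSpace.exp (H T)).trace := fun T hT => by
    by_contra! hlt
    obtain ⟨x, hx⟩ := hQ T hT
    refine hx.not_ge ?_
    have h3 := (hHs T).dotProduct_mulVec_le_of_trace_exp_le hlt.le x
    have h4 : ∀ e, (if e ∈ T then a e else b e) =
        y * ((if e ∈ T then 1 else 0) - q e) - ρ * y ^ 2 := fun e => by
      split_ifs <;> simp [ha, hb]
    have h5 : x ⬝ᵥ x = ∑ i, x i ^ 2 := by simp [dotProduct, pow_two]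
    have h6 := mul_le_mul_of_nonneg_left (sum_sq_sub_le x) (mul_nonneg hρ (sq_nonneg y))
    simp only [hH] at h3
    rw [sum_proj_quadForm, h5] at h3
    simp only [h4, sub_mul _ (ρ * y ^ 2), Finset.sum_sub_distrib, mul_assoc y,
      ← Finset.mul_sum] at h3
    linarith
  rw [Real.exp_neg, ← div_eq_mul_inv, le_div_iff₀ (Real.exp_pos r), Finset.sum_mul]
  refine le_trans ?_ h1
  refine le_trans (Finset.sum_le_sum fun T hT => mul_le_mul_of_nonneg_left
    (h2 T (Finset.mem_filter.1 hT).2) (hw T)) ?_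
  exact Finset.sum_le_sum_of_subset_of_nonneg (Finset.subset_univ _)
    fun T _ _ => mul_nonneg (hw T) (htr T)

end OrderedPair

/-! ### The law of the random edge set. -/

namespace OrderedPair

variable {N : ℕ} {Ω : Type*} [MeasurableSpace Ω] {μ : Measure Ω} [IsProbabilityMeasure μ]

open Classical in
theorem measureReal_setOf_eq_sum_weight {A : OrderedPair N → Set Ω} {q : OrderedPair N → ℝ}
    (hA : ∀ e, MeasurableSet (A e)) (hq : ∀ e, μ.real (A e) = q e) (hi : iIndepSet A μ)
    (Q : Finset (OrderedPair N) → Prop) [DecidablePred Q] :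
    μ.real {ω | Q (Finset.univ.filter fun e => ω ∈ A e)} =
      ∑ T : Finset (OrderedPair N) with Q T, weight q T := by
  set B : Finset (OrderedPair N) → OrderedPair N → Set Ω :=
    fun T e => if e ∈ T then A e else (A e)ᶜ with hB
  have hBm : ∀ T, MeasurableSet (⋂ e, B T e) := fun T => MeasurableSet.iInter fun e => by
    simp only [hB]
    split_ifs
    · exact hA e
    · exact (hA e).compl
  have hmem : ∀ T ω, ω ∈ (⋂ e, B T e) ↔ (Finset.univ.filter fun e => ω ∈ A e) = T := by
    intro T ω
    simp only [Set.mem_iInter, Finset.ext_iff, Finset.mem_filter, Finset.mem_univ, true_and]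
    refine forall_congr' fun e => ?_
    by_cases h : e ∈ T <;> simp [hB, h]
  have hw : ∀ T, μ.real (⋂ e, B T e) = weight q T := fun T => by
    -- Independence of the generated σ-algebras also covers the complements of the events.
    have h1 : ∀ e, MeasurableSet[MeasurableSpace.generateFrom {A e}] (B T e) := fun e => by
      have h2 : MeasurableSet[MeasurableSpace.generateFrom {A e}] (A e) :=
        MeasurableSpace.measurableSet_generateFrom (Set.mem_singleton _)
      simp only [hB]
      split_ifs
      · exact h2
      · exact h2.compl
    rw [Measure.real, iIndep.meas_iInter hi h1, ENNReal.toReal_prod, weight]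
    refine Finset.prod_congr rfl fun e _ => ?_
    simp only [hB]
    split_ifs
    · exact hq e
    · rw [← hq e]
      exact probReal_compl_eq_one_sub (hA e)
  have hU : {ω | Q (Finset.univ.filter fun e => ω ∈ A e)} =
      ⋃ T ∈ Finset.univ.filter Q, ⋂ e, B T e := by
    ext ω
    simp only [Set.mem_ofPred_eq, Set.mem_iUnion, exists_prop, hmem, Finset.mem_filter,
      Finset.mem_univ, true_and]
    exact ⟨fun h => ⟨_, h, rfl⟩, fun ⟨T, h, hT⟩ => hT ▸ h⟩
  rw [hU, measureReal_biUnion_finset _ fun T _ => hBm T]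
  · exact Finset.sum_congr rfl fun T _ => hw T
  · intro T _ T' _ hne
    refine Set.disjoint_left.2 fun ω h h' => hne ?_
    rw [← (hmem T ω).1 h, ← (hmem T' ω).1 h']

end OrderedPair

/-! ### Concentration of the centred matrix Laplacian. -/

namespace Graphon

open Classical in
/-- The Laplacian of the centred adjacency matrix has small operator norm with high probability. -/
theorem IsSample.one_sub_le_measureReal {w : Graphon} {ρ : ℝ} {N : ℕ} {Ω : Type*}
    [MeasurableSpace Ω] {μ : Measure Ω} [IsProbabilityMeasure μ] {G : Ω → SimpleGraph (Fin N)}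
    (hG : w.IsSample ρ μ G) (hρ : 0 < ρ) (hρ1 : ρ ≤ 1) (hN : 1 ≤ N) {l : ℝ} (hl : 0 < l)
    (hlN : 4 * l ≤ 9 * (ρ * N)) :
    1 - 2 * (N * Real.exp (-l)) ≤ μ.real {ω | ∀ x : Fin N → ℝ,
      |∑ i, x i * ∑ j, ((G ω).adjMatrix ℝ i j - ρ * w.modelMatrix N i j) * (x i - x j)| ≤
        3 * Real.sqrt (ρ * N * l) * ∑ i, x i ^ 2} := by
  set n : ℝ := ρ * N with hn
  have hn0 : 0 < n := mul_pos hρ (by exact_mod_cast hN)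
  -- With this `s`, `(2l + n s²) / s = 3 √(n l)`, and `s ≤ 3/2` is exactly `4 l ≤ 9 n`.
  set s : ℝ := Real.sqrt (l / n) with hs
  have hs0 : 0 < s := Real.sqrt_pos.2 (div_pos hl hn0)
  have hss : s ^ 2 = l / n := Real.sq_sqrt (div_pos hl hn0).le
  have hs1 : s ≤ 3 / 2 := by
    refine Real.sqrt_le_iff.2 ⟨by norm_num, ?_⟩
    rw [div_le_iff₀ hn0]
    linarith
  have hns : Real.sqrt (n * l) = n * s := by
    rw [show n * l = n ^ 2 * (l / n) by field_simp, Real.sqrt_mul (sq_nonneg n),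
      Real.sqrt_sq hn0.le]
  have hl' : l = n * s ^ 2 := by rw [hss]; field_simp
  set A : OrderedPair N → Set Ω := fun e => {ω | (G ω).Adj e.1.1 e.1.2} with hA
  set q : OrderedPair N → ℝ := fun e => ρ * w.modelMatrix N e.1.1 e.1.2 with hq
  have hq0 : ∀ e, 0 ≤ q e := fun e => mul_nonneg hρ.le (w.nonneg' _ _)
  have hqρ : ∀ e, q e ≤ ρ := fun e => mul_le_of_le_one_right hρ.le (w.le_one' _ _)
  have hAm : ∀ e, MeasurableSet (A e) := fun e => hG.measurableSet_adj _ _ e.2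
  have hprob : ∀ e, μ.real (A e) = q e := fun e => hG.prob_adj _ _ e.2
  set Q : ℝ → Finset (OrderedPair N) → Prop := fun y T => ∀ x : Fin N → ℝ,
    y * ∑ e, ((if e ∈ T then 1 else 0) - q e) * (x e.1.1 - x e.1.2) ^ 2 ≤
      (2 * l + ρ * y ^ 2 * N) * ∑ i, x i ^ 2 with hQ
  set B : ℝ → Set Ω := fun y => {ω | ¬ Q y (Finset.univ.filter fun e => ω ∈ A e)} with hB
  have hBle : ∀ y ≤ 3 / 2, μ.real (B y) ≤ N * Real.exp (-l) := fun y hy => by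
    rw [hB]
    dsimp only
    rw [OrderedPair.measureReal_setOf_eq_sum_weight hAm hprob hG.indep_adj (fun T => ¬ Q y T)]
    refine OrderedPair.sum_weight_filter_le hq0 hqρ (fun e => (hqρ e).trans hρ1) hρ.le hy
      fun T hT => ?_
    simp only [hQ] at hT
    push Not at hT
    exact hT
  have hU : μ.real (B s ∪ B (-s)) ≤ 2 * (N * Real.exp (-l)) := by
    have := measureReal_union_le (μ := μ) (B s) (B (-s))
    linarith [hBle s hs1, hBle (-s) (by linarith)]
  set good : Set Ω := {ω | ∀ x : Fin N → ℝ,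
      |∑ i, x i * ∑ j, ((G ω).adjMatrix ℝ i j - ρ * w.modelMatrix N i j) * (x i - x j)| ≤
        3 * Real.sqrt (n * l) * ∑ i, x i ^ 2} with hgood
  -- Covering and subadditivity avoid any measurability of `good`; the two signs give the two sides
  -- of the absolute value.
  have hcover : Set.univ ⊆ good ∪ (B s ∪ B (-s)) := by
    intro ω _
    by_contra hω
    simp only [Set.mem_union, not_or, hB, Set.mem_ofPred_eq, not_not, hQ] at hω
    obtain ⟨h1, h2, h3⟩ := hω
    refine h1 fun x => ?_
    have h4 := OrderedPair.laplacian_quadForm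
      (u := fun i j => (G ω).adjMatrix ℝ i j - ρ * w.modelMatrix N i j) (fun i j => by
        simp only [SimpleGraph.adjMatrix_apply, (G ω).adj_comm i j, modelMatrix, w.symm']) x
    have h5 : ∑ e : OrderedPair N, ((G ω).adjMatrix ℝ e.1.1 e.1.2 -
        ρ * w.modelMatrix N e.1.1 e.1.2) * (x e.1.1 - x e.1.2) ^ 2 =
        ∑ e, ((if e ∈ Finset.univ.filter (fun e => ω ∈ A e) then 1 else 0) - q e) *
          (x e.1.1 - x e.1.2) ^ 2 :=
      Finset.sum_congr rfl fun e _ => by simp [hA, hq, SimpleGraph.adjMatrix_apply]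
    rw [h4, h5, hns]
    have h6 := h2 x
    have h7 := h3 x
    set X := ∑ e, ((if e ∈ Finset.univ.filter (fun e => ω ∈ A e) then 1 else 0) - q e) *
          (x e.1.1 - x e.1.2) ^ 2
    set Y := ∑ i, x i ^ 2
    have h8 : (2 * l + ρ * s ^ 2 * N) * Y = s * (3 * (n * s) * Y) := by
      rw [hl', hn]; ring
    rw [neg_sq, h8] at h7
    rw [h8] at h6
    refine abs_le.2 ⟨?_, le_of_mul_le_mul_left h6 hs0⟩
    refine neg_le.1 (le_of_mul_le_mul_left ?_ hs0)
    linarith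
  have h1 : (1 : ℝ) ≤ μ.real good + μ.real (B s ∪ B (-s)) := by
    have := (measureReal_mono hcover).trans (measureReal_union_le (μ := μ) _ _)
    simpa using this
  linarith

end Graphon

/-! ### Operator norms of graphon Laplacians and reduction to matrices. -/

namespace Graphon

theorem norm_sq_eq_integral (f : L2) : ‖f‖ ^ 2 = ∫ x, f x ^ 2 := by
  rw [← real_inner_self_eq_norm_sq, L2.inner_def]
  simp [pow_two]

theorem integrable_sq (f : L2) : Integrable (fun x => f x ^ 2) volume :=
  (Lp.memLp f).integrable_sq

theorem norm_laplacian_sub_laplacian_le {u v : Graphon} {c : ℝ} (hc : 0 ≤ c)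
    (h : ∀ x y, |u x y - v x y| ≤ c) : ‖u.laplacian - v.laplacian‖ ≤ 2 * c := by
  refine ContinuousLinearMap.opNorm_le_bound _ (by positivity) fun f => ?_
  have hm : MemLp (fun _ : unitInterval => ∫ y, |f y|) 2 volume := memLp_const _
  have h1 : ‖(u.laplacian - v.laplacian) f‖ ≤ c * ‖(Lp.memLp f).abs.toLp _ + hm.toLp _‖ := by
    refine Lp.norm_le_mul_norm_of_ae_le_mul ?_
    rw [_root_.sub_apply]
    filter_upwards [Lp.coeFn_sub (u.laplacian f) (v.laplacian f), u.laplacian_ae_eq f,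
      v.laplacian_ae_eq f, Lp.coeFn_add ((Lp.memLp f).abs.toLp _) (hm.toLp _),
      (Lp.memLp f).abs.coeFn_toLp, hm.coeFn_toLp] with x h1 h2 h3 h4 h5 h6
    have hi : Integrable (fun y => f x - f y) volume :=
      (integrable_const (f x)).sub (integrable_coe f)
    rw [h1, h4, Pi.sub_apply, Pi.add_apply, h2, h3, h5, h6,
      ← integral_sub (u.integrable_mul hi x) (v.integrable_mul hi x)]
    have h7 : ‖∫ y, (u x y * (f x - f y) - v x y * (f x - f y))‖ ≤ ∫ y, c * (|f x| + |f y|) := by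
      refine norm_integral_le_of_norm_le
        (((integrable_const |f x|).add (integrable_coe f).abs).const_mul c)
        (Filter.Eventually.of_forall fun y => ?_)
      rw [← sub_mul, Real.norm_eq_abs, abs_mul]
      exact mul_le_mul (h x y) (abs_sub _ _) (abs_nonneg _) hc
    rw [integral_const_mul, integral_add (integrable_const _) (integrable_coe f).abs] at h7
    refine h7.trans (mul_le_mul_of_nonneg_left ?_ hc)
    simpa using le_abs_self (|f x| + ∫ y, |f y|)
  have h2 : ‖(Lp.memLp f).abs.toLp _‖ ≤ ‖f‖ := by
    refine Lp.norm_le_norm_of_ae_le ?_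
    filter_upwards [(Lp.memLp f).abs.coeFn_toLp] with x h1
    rw [h1]
    simp
  have h3 : ‖hm.toLp _‖ ≤ ‖f‖ := by
    have h0 : 0 ≤ ∫ y, |f y| := integral_nonneg fun _ => abs_nonneg _
    refine le_trans (le_of_eq ?_) (integral_abs_le f)
    rw [Lp.norm_toLp, eLpNorm_const _ (by norm_num) (NeZero.ne _)]
    simp [abs_of_nonneg h0]
  calc _ ≤ _ := h1
    _ ≤ c * (‖f‖ + ‖f‖) :=
      mul_le_mul_of_nonneg_left ((norm_add_le _ _).trans (add_le_add h2 h3)) hc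
    _ = 2 * c * ‖f‖ := by ring

section Cell

variable {N : ℕ}

theorem exists_mem_cell (hN : 1 ≤ N) (x : unitInterval) : ∃ i, x ∈ cell N i := by
  have hN0 : (0 : ℝ) < N := by exact_mod_cast hN
  rcases x.2.1.eq_or_lt with h0 | h0
  · exact ⟨⟨0, hN⟩, Or.inl rfl, by rw [← h0]; positivity⟩
  · have hpos : 0 < ⌈(N : ℝ) * x⌉₊ := Nat.ceil_pos.2 (mul_pos hN0 h0)
    have hle : ⌈(N : ℝ) * x⌉₊ ≤ N := Nat.ceil_le.2 (mul_le_of_le_one_right hN0.le x.2.2)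
    have hc : ((⌈(N : ℝ) * x⌉₊ - 1 : ℕ) : ℝ) = ⌈(N : ℝ) * x⌉₊ - 1 := by
      rw [Nat.cast_sub hpos, Nat.cast_one]
    refine ⟨⟨⌈(N : ℝ) * x⌉₊ - 1, by omega⟩, Or.inr ?_, ?_⟩
    · simp only [hc]
      rw [div_lt_iff₀ hN0]
      linarith [Nat.ceil_lt_add_one (mul_pos hN0 h0).le]
    · simp only [hc]
      rw [le_div_iff₀ hN0]
      linarith [Nat.le_ceil ((N : ℝ) * x)]

theorem pairwise_disjoint_cell : Pairwise (Function.onFun Disjoint (cell N)) :=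
  fun _ _ hne => Set.disjoint_left.2 fun _ hi hj =>
    hne (le_antisymm (cell_index_le hj hi) (cell_index_le hi hj))

theorem iUnion_cell (hN : 1 ≤ N) : ⋃ i, cell N i = Set.univ :=
  Set.eq_univ_of_forall fun x => Set.mem_iUnion.2 (exists_mem_cell hN x)

theorem measureReal_cell (i : Fin N) : volume.real (cell N i) = (N : ℝ)⁻¹ := by
  have hN0 : (0 : ℝ) < N := by exact_mod_cast Fin.pos i
  by_cases h0 : (i : ℕ) = 0
  · have : cell N i = Set.Iic (vertex N i) := by
      ext x
      simp [cell, vertex, h0, ← Subtype.coe_le_coe]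
    rw [this, Measure.real, unitInterval.volume_Iic, ENNReal.toReal_ofReal (vertex N i).2.1]
    simp [vertex, h0]
  · have hl : (i : ℝ) / N ≤ 1 := div_le_one_of_le₀ (by exact_mod_cast i.isLt.le) hN0.le
    have : cell N i = Set.Ioc ⟨(i : ℝ) / N, by positivity, hl⟩ (vertex N i) := by
      ext x
      simp [cell, vertex, h0, ← Subtype.coe_le_coe, ← Subtype.coe_lt_coe]
    have h1 : (vertex N i : ℝ) - (i : ℝ) / N = (N : ℝ)⁻¹ := by
      simp only [vertex]
      ring
    rw [this, Measure.real, unitInterval.volume_Ioc, h1, ENNReal.toReal_ofReal (by positivity)]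

theorem abs_sub_vertex_le {i : Fin N} {x : unitInterval} (hx : x ∈ cell N i) :
    |(x : ℝ) - vertex N i| ≤ 1 / N := by
  have h1 : (i : ℝ) / N ≤ x := by
    rcases hx.1 with h | h
    · simpa [h] using x.2.1
    · exact h.le
  have h2 := hx.2
  simp only [vertex]
  rw [abs_le]
  rw [add_div] at h2 ⊢
  constructor <;> linarith [div_nonneg zero_le_one (Nat.cast_nonneg (α := ℝ) N)]

theorem integral_eq_sum_cell (hN : 1 ≤ N) {h : unitInterval → ℝ} (hh : Integrable h volume) :
    ∫ x, h x = ∑ i, ∫ x in cell N i, h x := by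
  rw [← integral_iUnion_fintype (measurableSet_cell N) pairwise_disjoint_cell
    fun i => hh.integrableOn, iUnion_cell hN, setIntegral_univ]

theorem sum_mul_indicator_cell {i : Fin N} {x : unitInterval} (hx : x ∈ cell N i)
    (a : Fin N → ℝ) : ∑ k, a k * (cell N k).indicator (1 : unitInterval → ℝ) x = a i := by
  rw [Finset.sum_eq_single i]
  · simp [hx]
  · intro k _ hk
    rw [Set.indicator_of_notMem fun h => hk (le_antisymm (cell_index_le hx h) (cell_index_le h hx)),
      mul_zero]
  · simp

theorem step_apply {A : Matrix (Fin N) (Fin N) ℝ} (hs : ∀ i j, A i j = A j i)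
    (h0 : ∀ i j, 0 ≤ A i j) (h1 : ∀ i j, A i j ≤ 1) {i j : Fin N} {x y : unitInterval}
    (hx : x ∈ cell N i) (hy : y ∈ cell N j) : step A hs h0 h1 x y = A i j := by
  change ∑ k, ∑ l, A k l * (cell N k).indicator (1 : unitInterval → ℝ) x *
    (cell N l).indicator (1 : unitInterval → ℝ) y = A i j
  simp_rw [sum_mul_indicator_cell hy fun l => A _ l * (cell N _).indicator 1 x]
  exact sum_mul_indicator_cell hx fun k => A k j

theorem sampled_apply (w : Graphon) {i j : Fin N} {x y : unitInterval} (hx : x ∈ cell N i)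
    (hy : y ∈ cell N j) : w.sampled N x y = w (vertex N i) (vertex N j) :=
  step_apply _ _ _ hx hy

theorem norm_sampled_laplacian_sub_le {w : Graphon} {K : ℝ} (hK : 0 ≤ K) (hw : w.IsLipschitz K)
    (hN : 1 ≤ N) : ‖(w.sampled N).laplacian - w.laplacian‖ ≤ 4 * K / N := by
  have hN0 : (0 : ℝ) < N := by exact_mod_cast hN
  refine (norm_laplacian_sub_laplacian_le (c := 2 * K / N) (by positivity) fun x y => ?_).trans_eq
    (by ring)
  obtain ⟨i, hi⟩ := exists_mem_cell hN x
  obtain ⟨j, hj⟩ := exists_mem_cell hN y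
  have h1 := abs_sub_vertex_le hi
  have h2 := abs_sub_vertex_le hj
  rw [w.sampled_apply hi hj, abs_sub_comm]
  refine (hw _ _ _ _).trans ((mul_le_mul_of_nonneg_left (add_le_add h1 h2) hK).trans_eq ?_)
  ring

theorem integral_step_mul_sub {A : Matrix (Fin N) (Fin N) ℝ} (hs : ∀ i j, A i j = A j i)
    (h0 : ∀ i j, 0 ≤ A i j) (h1 : ∀ i j, A i j ≤ 1) (f : L2) {i : Fin N} {x : unitInterval}
    (hx : x ∈ cell N i) (c : ℝ) :
    ∫ y, step A hs h0 h1 x y * (c - f y) =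
      ∑ j, A i j * (c / N - ∫ y in cell N j, f y) := by
  have hi : Integrable (fun y => c - f y) volume := (integrable_const c).sub (integrable_coe f)
  rw [integral_eq_sum_cell (Fin.pos i) ((step A hs h0 h1).integrable_mul hi x)]
  refine Finset.sum_congr rfl fun j _ => ?_
  rw [setIntegral_congr_fun (g := fun y => A i j * (c - f y)) (measurableSet_cell N j)
    fun y hy => by simp only [step_apply hs h0 h1 hx hy], integral_const_mul,
    integral_sub (integrable_const _) (integrable_coe f).integrableOn, setIntegral_const,
    measureReal_cell, smul_eq_mul]
  ring

/-- On a cell `f` minus its mean is orthogonal to constants, so the cross term vanishes. -/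
theorem setIntegral_cell_sq (f : L2) (i : Fin N) (a b : ℝ) :
    ∫ x in cell N i, (a * (f x - N * ∫ y in cell N i, f y) + b) ^ 2 =
      a ^ 2 * (∫ x in cell N i, (f x - N * ∫ y in cell N i, f y) ^ 2) + b ^ 2 / N := by
  have hN0 : (N : ℝ) ≠ 0 := by exact_mod_cast (Fin.pos i).ne'
  set g := N * ∫ y in cell N i, f y with hg
  have h1 : IntegrableOn (fun x => f x - g) (cell N i) volume :=
    ((integrable_coe f).sub (integrable_const g)).integrableOn
  have h2 : IntegrableOn (fun x => (f x - g) ^ 2) (cell N i) volume :=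
    ((Lp.memLp f).sub (memLp_const g)).integrable_sq.integrableOn
  have h3 : ∫ x in cell N i, (f x - g) = 0 := by
    rw [integral_sub (integrable_coe f).integrableOn (integrable_const _), setIntegral_const,
      measureReal_cell, smul_eq_mul, hg, ← mul_assoc, inv_mul_cancel₀ hN0, one_mul, sub_self]
  have h4 : ∀ x, (a * (f x - g) + b) ^ 2 = a ^ 2 * (f x - g) ^ 2 + 2 * a * b * (f x - g) + b ^ 2 :=
    fun x => by ring
  simp_rw [h4]
  rw [integral_add (f := fun x => a ^ 2 * (f x - g) ^ 2 + 2 * a * b * (f x - g))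
      (g := fun _ => b ^ 2) ((h2.const_mul _).add (h1.const_mul _)) (integrable_const _),
    integral_add (f := fun x => a ^ 2 * (f x - g) ^ 2) (g := fun x => 2 * a * b * (f x - g))
      (h2.const_mul _) (h1.const_mul _), integral_const_mul, integral_const_mul, h3,
    setIntegral_const, measureReal_cell, smul_eq_mul]
  ring

theorem norm_smul_step_laplacian_sub_le {A B : Matrix (Fin N) (Fin N) ℝ}
    (hA : ∀ i j, A i j = A j i) (hA0 : ∀ i j, 0 ≤ A i j) (hA1 : ∀ i j, A i j ≤ 1)
    (hB : ∀ i j, B i j = B j i) (hB0 : ∀ i j, 0 ≤ B i j) (hB1 : ∀ i j, B i j ≤ 1)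
    (hN : 1 ≤ N) {c t : ℝ} (ht : 0 ≤ t) (hrow : ∀ i, |∑ j, (c * A i j - B i j)| ≤ t)
    (hmat : ∀ g : Fin N → ℝ, ∑ i, (∑ j, (c * A i j - B i j) * (g i - g j)) ^ 2 ≤
      t ^ 2 * ∑ i, g i ^ 2) :
    ‖c • (step A hA hA0 hA1).laplacian - (step B hB hB0 hB1).laplacian‖ ≤ t / N := by
  have hN0 : (0 : ℝ) < N := by exact_mod_cast hN
  set T := c • (step A hA hA0 hA1).laplacian - (step B hB hB0 hB1).laplacian with hT
  refine ContinuousLinearMap.opNorm_le_bound _ (by positivity) fun f => ?_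
  set g : Fin N → ℝ := fun i => N * ∫ y in cell N i, f y with hg
  set α : Fin N → ℝ := fun i => (∑ j, (c * A i j - B i j)) / N with hα
  set β : Fin N → ℝ := fun i => (∑ j, (c * A i j - B i j) * (g i - g j)) / N with hβ
  set V : Fin N → ℝ := fun i => ∫ x in cell N i, (f x - g i) ^ 2 with hV
  have hV0 : ∀ i, 0 ≤ V i := fun i => integral_nonneg fun _ => sq_nonneg _
  -- Writing `f x - g j = (f x - g i) + (g i - g j)` separates the row sum from the matrix Laplacian
  -- of the averages.
  have hTf : ∀ᵐ x, ∀ i, x ∈ cell N i → T f x = α i * (f x - g i) + β i := by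
    rw [hT, _root_.sub_apply, _root_.smul_apply]
    filter_upwards [Lp.coeFn_sub (c • (step A hA hA0 hA1).laplacian f)
      ((step B hB hB0 hB1).laplacian f), Lp.coeFn_smul c ((step A hA hA0 hA1).laplacian f),
      (step A hA hA0 hA1).laplacian_ae_eq f, (step B hB hB0 hB1).laplacian_ae_eq f]
      with x h1 h2 h3 h4 i hi
    rw [h1, Pi.sub_apply, h2, Pi.smul_apply, h3, h4, integral_step_mul_sub _ _ _ f hi,
      integral_step_mul_sub _ _ _ f hi, smul_eq_mul, hα, hβ]
    have h5 : ∀ j, ∫ y in cell N j, f y = g j / N := fun j => by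
      simp only [hg]
      field_simp
    simp only [h5]
    rw [Finset.mul_sum, ← Finset.sum_sub_distrib, div_mul_eq_mul_div, ← add_div, Finset.sum_mul,
      ← Finset.sum_add_distrib, Finset.sum_div]
    exact Finset.sum_congr rfl fun j _ => by ring
  have h1 : ‖T f‖ ^ 2 = ∑ i, (α i ^ 2 * V i + β i ^ 2 / N) := by
    rw [norm_sq_eq_integral, integral_eq_sum_cell hN (integrable_sq _)]
    refine Finset.sum_congr rfl fun i _ => ?_
    rw [← setIntegral_cell_sq f i (α i) (β i)]
    refine setIntegral_congr_ae (measurableSet_cell N i) ?_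
    filter_upwards [hTf] with x hx hxi
    rw [hx i hxi]
  have h2 : ‖f‖ ^ 2 = ∑ i, (V i + g i ^ 2 / N) := by
    rw [norm_sq_eq_integral, integral_eq_sum_cell hN (integrable_sq _)]
    refine Finset.sum_congr rfl fun i _ => ?_
    have := setIntegral_cell_sq f i 1 (g i)
    simpa [hg, hV] using this
  have hα2 : ∀ i, α i ^ 2 ≤ (t / N) ^ 2 := fun i => by
    rw [← sq_abs, hα]
    dsimp only
    rw [abs_div, abs_of_pos hN0]
    gcongr
    exact hrow i
  have hβ2 : ∑ i, β i ^ 2 ≤ (t / N) ^ 2 * ∑ i, g i ^ 2 := by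
    simp only [hβ, div_pow]
    rw [← Finset.sum_div, div_mul_eq_mul_div]
    gcongr
    exact hmat g
  refine le_of_sq_le_sq ?_ (by positivity)
  calc ‖T f‖ ^ 2 = ∑ i, α i ^ 2 * V i + (∑ i, β i ^ 2) / N := by
        rw [h1, Finset.sum_add_distrib, Finset.sum_div]
    _ ≤ ∑ i, (t / N) ^ 2 * V i + ((t / N) ^ 2 * ∑ i, g i ^ 2) / N := by
        refine add_le_add (Finset.sum_le_sum fun i _ =>
          mul_le_mul_of_nonneg_right (hα2 i) (hV0 i)) ?_
        gcongr
    _ = (t / N * ‖f‖) ^ 2 := by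
        rw [mul_pow, h2, Finset.sum_add_distrib, ← Finset.mul_sum, ← Finset.sum_div]
        ring

end Cell

end Graphon

/-! ### Thresholds, the degenerate case and assembly. -/

namespace Graphon

open Classical in
theorem norm_smul_ofGraph_laplacian_sub_sampled_le (w : Graphon) {N : ℕ} (hN : 1 ≤ N)
    (H : SimpleGraph (Fin N)) {ρ t s : ℝ} (hρ : 0 < ρ) (ht : 0 < t) (hts : t + ρ ≤ s)
    (h : ∀ x : Fin N → ℝ,
      |∑ i, x i * ∑ j, (H.adjMatrix ℝ i j - ρ * w.modelMatrix N i j) * (x i - x j)| ≤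
        t * ∑ i, x i ^ 2) :
    ‖ρ⁻¹ • (ofGraph H).laplacian - (w.sampled N).laplacian‖ ≤ s / (ρ * N) := by
  have hs : 0 ≤ s := by linarith
  have hu : ∀ i j, ρ⁻¹ * H.adjMatrix ℝ i j - w.modelMatrix N i j =
      ρ⁻¹ * (H.adjMatrix ℝ i j - ρ * w.modelMatrix N i j) := fun i j => by
    rw [mul_sub, inv_mul_cancel_left₀ hρ.ne']
  have hsymm : ∀ i j, H.adjMatrix ℝ i j - ρ * w.modelMatrix N i j =
      H.adjMatrix ℝ j i - ρ * w.modelMatrix N j i := fun i j => by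
    simp only [SimpleGraph.adjMatrix_apply, H.adj_comm i j, modelMatrix, w.symm']
  rw [← div_div, ← inv_mul_eq_div ρ s]
  refine norm_smul_step_laplacian_sub_le _ _ _ _ _ _ hN (by positivity) (fun i => ?_) fun g => ?_
  · simp_rw [hu]
    rw [← Finset.mul_sum, abs_mul, abs_of_pos (inv_pos.2 hρ)]
    refine mul_le_mul_of_nonneg_left ?_ (inv_pos.2 hρ).le
    -- The graph has no loops but `modelMatrix` has a diagonal; its entry costs at most `ρ`.
    refine (OrderedPair.abs_row_sum_le h i).trans (le_trans ?_ hts)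
    have h1 := w.nonneg' (vertex N i) (vertex N i)
    have h2 := w.le_one' (vertex N i) (vertex N i)
    rw [SimpleGraph.adjMatrix_apply, if_neg (H.irrefl), zero_sub, abs_neg, modelMatrix,
      abs_of_nonneg (mul_nonneg hρ.le h1)]
    gcongr
    exact mul_le_of_le_one_right hρ.le h2
  · simp_rw [hu, mul_assoc, ← Finset.mul_sum, mul_pow]
    rw [← Finset.mul_sum, mul_assoc]
    refine mul_le_mul_of_nonneg_left ?_ (by positivity)
    refine (OrderedPair.sum_sq_laplacian_le hsymm ht h g).trans ?_
    gcongr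
    linarith

theorem degree_nonneg (w : Graphon) (x : unitInterval) : 0 ≤ w.degree x :=
  integral_nonneg fun y => w.nonneg' x y

theorem degree_le_one (w : Graphon) (x : unitInterval) : w.degree x ≤ 1 := by
  have h := integral_mono_of_nonneg (μ := (volume : Measure unitInterval))
    (Filter.Eventually.of_forall fun y => w.nonneg' x y) (integrable_const (1 : ℝ))
    (Filter.Eventually.of_forall fun y => w.le_one' x y)
  simpa [degree] using h

theorem degree_le_maxDegree (w : Graphon) (x : unitInterval) : w.degree x ≤ w.maxDegree :=
  le_ciSup (f := w.degree) ⟨1, by rintro _ ⟨y, rfl⟩; exact w.degree_le_one y⟩ x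

theorem maxDegree_nonneg (w : Graphon) : 0 ≤ w.maxDegree :=
  (w.degree_nonneg 0).trans (w.degree_le_maxDegree 0)

theorem maxDegree_le_one (w : Graphon) : w.maxDegree ≤ 1 := ciSup_le w.degree_le_one

theorem isOpenPosMeasure_unitInterval : (volume : Measure unitInterval).IsOpenPosMeasure := by
  refine ⟨fun U hU hne => ?_⟩
  obtain ⟨V, hV, rfl⟩ := isOpen_induced_iff.1 hU
  obtain ⟨x, hx⟩ := hne
  have hx1 : (x : ℝ) ∈ closure (Set.Ioo (0 : ℝ) 1) := by
    rw [closure_Ioo zero_ne_one]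
    exact x.2
  have hpos := (hV.inter isOpen_Ioo).measure_pos volume (mem_closure_iff.1 hx1 V hV hx)
  rw [unitInterval.volume_apply]
  refine (hpos.trans_le (measure_mono fun z hz => ?_)).ne'
  exact ⟨⟨z, hz.2.1.le, hz.2.2.le⟩, hz.1, rfl⟩

/-- Vanishing everywhere, not just almost everywhere, matters because edge probabilities sample `w`
at single points; continuity provides it. -/
theorem eq_zero_of_maxDegree_eq_zero {w : Graphon} {K : ℝ} (hw : w.IsLipschitz K)
    (h : w.maxDegree = 0) (x y : unitInterval) : w x y = 0 := by
  have hd : w.degree x = 0 := le_antisymm (h ▸ w.degree_le_maxDegree x) (w.degree_nonneg x)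
  have hc : Continuous (w x) := by
    refine (LipschitzWith.of_dist_le_mul (K := K.toNNReal) fun a b => ?_).continuous
    rw [Real.dist_eq, Subtype.dist_eq, Real.dist_eq]
    have h1 := hw x a x b
    rw [sub_self, abs_zero, zero_add] at h1
    exact h1.trans (mul_le_mul_of_nonneg_right (Real.le_coe_toNNReal K) (abs_nonneg _))
  have hi : Integrable (w x) volume := by simpa using w.integrable_mul (integrable_const (1 : ℝ)) x
  have := isOpenPosMeasure_unitInterval
  have hae : w x =ᵐ[volume] fun _ => 0 :=
    (integral_eq_zero_iff_of_nonneg (fun y => w.nonneg' x y) hi).1 hd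
  exact congrFun ((hc.ae_eq_iff_eq volume continuous_const).1 hae) y

theorem laplacian_eq_zero {u : Graphon} (h : ∀ x y, u x y = 0) : u.laplacian = 0 := by
  ext1 f
  refine Lp.ext ?_
  filter_upwards [u.laplacian_ae_eq f, Lp.coeFn_zero ℝ 2 (volume : Measure unitInterval)]
    with x h1 h2
  rw [h1, _root_.zero_apply, h2]
  simp [h]

theorem sparsity_pos (τ : ℝ) {N : ℕ} (hN : 1 ≤ N) : 0 < sparsity τ N :=
  Real.rpow_pos_of_pos (by exact_mod_cast hN) _

theorem sparsity_le_one {τ : ℝ} (hτ : 0 ≤ τ) {N : ℕ} (hN : 1 ≤ N) : sparsity τ N ≤ 1 :=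
  Real.rpow_le_one_of_one_le_of_nonpos (by exact_mod_cast hN) (neg_nonpos.2 hτ)

theorem sparsity_mul (τ : ℝ) {N : ℕ} (hN : 1 ≤ N) : sparsity τ N * N = (N : ℝ) ^ (1 - τ) := by
  rw [sparsity, sub_eq_neg_add, Real.rpow_add_one (by exact_mod_cast (by omega : N ≠ 0))]

/-- The logarithm splits into `log 4 + log N - log (ε N)`, each term negligible against `ρ_N N = N ^
(1 - τ)`. -/
theorem thresholds_nonempty {w : Graphon} {K τ : ℝ} {ε : ℕ → ℝ} (hτ : τ < 1)
    (hw : 0 < w.maxDegree) (hε : ∀ N, 0 < ε N)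
    (hlog : Filter.Tendsto (fun N : ℕ => Real.log (ε N) / (N : ℝ) ^ (1 - τ)) Filter.atTop
      (nhds 0)) : (w.thresholds K τ ε).Nonempty := by
  have hτ' : 0 < 1 - τ := sub_pos.2 hτ
  have h1 : Filter.Tendsto (fun N : ℕ => Real.log 4 / (N : ℝ) ^ (1 - τ)) Filter.atTop (nhds 0) :=
    ((tendsto_rpow_atTop hτ').comp tendsto_natCast_atTop_atTop).const_div_atTop _
  have h2 : Filter.Tendsto (fun N : ℕ => Real.log N / (N : ℝ) ^ (1 - τ)) Filter.atTop (nhds 0) :=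
    (isLittleO_log_rpow_atTop hτ').tendsto_div_nhds_zero.comp tendsto_natCast_atTop_atTop
  have h3 : Filter.Tendsto (fun N : ℕ => 2 * K / (N : ℝ)) Filter.atTop (nhds 0) :=
    tendsto_const_div_atTop_nhds_zero_nat _
  have h4 := (((h1.add h2).sub hlog).const_mul (4 / 9)).add h3
  simp only [add_zero, sub_zero, mul_zero] at h4
  obtain ⟨n, hn⟩ := Filter.eventually_atTop.1 (h4.eventually_le_const hw)
  refine ⟨max n 1, le_max_right _ _, fun N hN => ?_⟩
  have hN1 : 1 ≤ N := (le_max_right _ _).trans hN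
  have hN0 : (0 : ℝ) < N := by exact_mod_cast hN1
  refine le_trans (le_of_eq ?_) (hn N ((le_max_left _ _).trans hN))
  rw [mul_assoc 9, sparsity_mul τ hN1, Real.log_div (by positivity) (hε N).ne',
    Real.log_mul (by norm_num) hN0.ne']
  ring

theorem errorBound_nonneg {K : ℝ} (hK : 0 ≤ K) (τ ε : ℝ) (N : ℕ) : 0 ≤ errorBound K τ ε N := by
  unfold errorBound
  positivity

theorem one_sub_le_measureReal_of_threshold {w : Graphon} {K τ ε : ℝ} (hK : 0 ≤ K)
    (hw : w.IsLipschitz K) (hτ : 0 ≤ τ) (hε0 : 0 < ε) (hε1 : ε ≤ 1) {N : ℕ} (hN : 1 ≤ N)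
    {Ω : Type*} [MeasurableSpace Ω] {μ : Measure Ω} [IsProbabilityMeasure μ]
    {G : Ω → SimpleGraph (Fin N)} (hG : w.IsSample (sparsity τ N) μ G)
    (h : 4 * Real.log (4 * N / ε) / (9 * sparsity τ N * N) + 2 * K / N ≤ w.maxDegree) :
    1 - ε ≤ μ.real {ω | ‖(sparsity τ N)⁻¹ • (ofGraph (G ω)).laplacian - w.laplacian‖
      ≤ errorBound K τ ε N} := by
  have hN1 : (1 : ℝ) ≤ N := by exact_mod_cast hN
  have hN0 : (0 : ℝ) < N := zero_lt_one.trans_le hN1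
  have hρ := sparsity_pos τ hN
  have hρ1 := sparsity_le_one hτ hN
  set ρ := sparsity τ N with hρdef
  set l := Real.log (4 * N / ε) with hldef
  -- Here `4N/ε ≥ 4 > e`.
  have hl1 : 1 ≤ l := by
    rw [hldef, Real.le_log_iff_exp_le (by positivity), le_div_iff₀ hε0]
    have := Real.exp_one_lt_d9
    have : Real.exp 1 * ε ≤ Real.exp 1 := mul_le_of_le_one_right (Real.exp_pos _).le hε1
    linarith
  have hl0 : 0 < l := zero_lt_one.trans_le hl1
  have hexp : 2 * (N * Real.exp (-l)) = ε / 2 := by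
    rw [hldef, Real.exp_neg, Real.exp_log (by positivity)]
    field_simp
    norm_num
  have hlN : 4 * l ≤ 9 * (ρ * N) := by
    have h1 : 4 * l / (9 * ρ * N) ≤ 1 := by
      have := w.maxDegree_le_one
      have : 0 ≤ 2 * K / N := by positivity
      linarith
    rw [div_le_one (by positivity)] at h1
    linarith
  have h1 := hG.one_sub_le_measureReal hρ hρ1 hN hl0 hlN
  rw [hexp] at h1
  refine le_trans (by linarith) (h1.trans (measureReal_mono fun ω hω => ?_))
  rw [Set.mem_ofPred_eq] at hω ⊢
  have hn0 : 0 < ρ * N := mul_pos hρ hN0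
  have hsq : 0 < Real.sqrt (ρ * N * l) := Real.sqrt_pos.2 (mul_pos hn0 hl0)
  -- The diagonal error fits into one extra multiple of the square root, turning the constant 3 into
  -- 4.
  have hρs : ρ ≤ Real.sqrt (ρ * N * l) := by
    refine Real.le_sqrt_of_sq_le ?_
    have : ρ ≤ N * l := hρ1.trans (one_le_mul_of_one_le_of_one_le hN1 hl1)
    rw [pow_two, mul_assoc]
    exact mul_le_mul_of_nonneg_left this hρ.le
  have h2 := w.norm_smul_ofGraph_laplacian_sub_sampled_le hN (G ω) hρ
    (t := 3 * Real.sqrt (ρ * N * l)) (s := 4 * Real.sqrt (ρ * N * l)) (by positivity)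
    (by linarith) hω
  have h3 : 4 * Real.sqrt (ρ * N * l) / (ρ * N) = 4 * Real.sqrt (l / (ρ * N)) := by
    rw [show ρ * N * l = (ρ * N) ^ 2 * (l / (ρ * N)) by field_simp,
      Real.sqrt_mul (sq_nonneg _), Real.sqrt_sq hn0.le]
    field_simp
  rw [h3] at h2
  calc _ = ‖(ρ⁻¹ • (ofGraph (G ω)).laplacian - (w.sampled N).laplacian) +
        ((w.sampled N).laplacian - w.laplacian)‖ := by rw [sub_add_sub_cancel]
    _ ≤ _ := norm_add_le _ _
    _ ≤ _ := add_le_add h2 (norm_sampled_laplacian_sub_le hK hw hN)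

theorem measureReal_eq_one_of_maxDegree_eq_zero {w : Graphon} {K τ ε : ℝ} (hK : 0 ≤ K)
    (hw : w.IsLipschitz K) (hd : w.maxDegree = 0) {N : ℕ} (hN : 1 ≤ N)
    {Ω : Type*} [MeasurableSpace Ω] {μ : Measure Ω} [IsProbabilityMeasure μ]
    {G : Ω → SimpleGraph (Fin N)} (hG : w.IsSample (sparsity τ N) μ G) :
    μ.real {ω | ‖(sparsity τ N)⁻¹ • (ofGraph (G ω)).laplacian - w.laplacian‖
      ≤ errorBound K τ ε N} = 1 := by
  have hw0 := eq_zero_of_maxDegree_eq_zero hw hd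
  have hadj : ∀ᵐ ω ∂μ, ∀ i j : Fin N, i < j → ¬ (G ω).Adj i j := by
    refine ae_all_iff.2 fun i => ae_all_iff.2 fun j => ?_
    by_cases hij : i < j
    · have h1 := hG.prob_adj i j hij
      rw [modelMatrix, hw0, mul_zero, measureReal_eq_zero_iff] at h1
      filter_upwards [measure_eq_zero_iff_ae_notMem.1 h1] with ω hω _ using hω
    · simp [hij]
  have hS : ∀ᵐ ω ∂μ, ‖(sparsity τ N)⁻¹ • (ofGraph (G ω)).laplacian - w.laplacian‖
      ≤ errorBound K τ ε N := by
    filter_upwards [hadj] with ω hω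
    have h0 : ∀ i j, ¬ (G ω).Adj i j := fun i j hij => by
      rcases hij.ne.lt_or_gt with h | h
      · exact hω i j h hij
      · exact hω j i h hij.symm
    have h1 : (ofGraph (G ω)).laplacian = 0 := laplacian_eq_zero fun x y => by
      obtain ⟨i, hi⟩ := exists_mem_cell hN x
      obtain ⟨j, hj⟩ := exists_mem_cell hN y
      exact (step_apply _ _ _ hi hj).trans (if_neg (h0 i j))
    rw [h1, laplacian_eq_zero hw0]
    simpa using errorBound_nonneg hK τ ε N
  rw [Measure.real, measure_congr (Filter.eventuallyEq_univ.2 hS), measure_univ,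
    ENNReal.toReal_one]

theorem one_sub_le_measureReal_of_sInf_thresholds_le {w : Graphon} {K τ : ℝ} {ε : ℕ → ℝ}
    (hK : 0 ≤ K) (hw : w.IsLipschitz K) (hτ : 0 ≤ τ) {N : ℕ} (hN : 1 ≤ N) (hε0 : 0 < ε N)
    (hε1 : ε N ≤ 1) (hne : 0 < w.maxDegree → (w.thresholds K τ ε).Nonempty)
    {Ω : Type*} [MeasurableSpace Ω] {μ : Measure Ω} [IsProbabilityMeasure μ]
    {G : Ω → SimpleGraph (Fin N)} (hG : w.IsSample (sparsity τ N) μ G)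
    (h : sInf (w.thresholds K τ ε) ≤ N) :
    1 - ε N ≤ μ.real {ω | ‖(sparsity τ N)⁻¹ • (ofGraph (G ω)).laplacian - w.laplacian‖
      ≤ errorBound K τ (ε N) N} := by
  -- `Nat.sInf_mem` needs a nonempty threshold set, guaranteed here only for positive `maxDegree`;
  -- degree zero is handled without thresholds.
  rcases w.maxDegree_nonneg.eq_or_lt with hd | hd
  · rw [measureReal_eq_one_of_maxDegree_eq_zero hK hw hd.symm hN hG]
    linarith
  · exact one_sub_le_measureReal_of_threshold hK hw hτ hε0 hε1 hN hG
      ((Nat.sInf_mem (hne hd)).2 N h)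

theorem epsGamma_pos (γ : ℝ) (N : ℕ) : 0 < epsGamma γ N := Real.exp_pos _

/-- Equality holds at `N = 1` for `γ ≠ 0`, so the probability estimates allow `ε = 1`. -/
theorem epsGamma_le_one (γ : ℝ) (N : ℕ) : epsGamma γ N ≤ 1 :=
  Real.exp_le_one_iff.2 (neg_nonpos.2 (Real.rpow_nonneg (Real.log_natCast_nonneg N) γ))

end Graphon

theorem mainTheorem7 (w : Graphon) (K : ℝ) (hK : 0 < K) (hw : w.IsLipschitz K)
    (τ : ℝ) (hτ0 : 0 ≤ τ) (hτ1 : τ < 1)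
    {Ω : ℕ → Type*} [∀ N, MeasurableSpace (Ω N)]
    (μ : ∀ N, Measure (Ω N)) [∀ N, IsProbabilityMeasure (μ N)]
    (G : ∀ N, Ω N → SimpleGraph (Fin N))
    (hG : ∀ N, 1 ≤ N → w.IsSample (Graphon.sparsity τ N) (μ N) (G N)) :
    (∀ N : ℕ, 1 ≤ N → ‖(w.sampled N).laplacian - w.laplacian‖ ≤ 4 * K / N) ∧
    (∀ ε : ℝ, 0 < ε → ε < 1 →
      (0 < w.maxDegree → (w.thresholds K τ fun _ => ε).Nonempty) ∧
      ∀ N : ℕ, 1 ≤ N → w.N₁ K τ ε ≤ N →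
        1 - ε ≤ (μ N).real {ω |
          ‖(Graphon.sparsity τ N)⁻¹ • (Graphon.ofGraph (G N ω)).laplacian - w.laplacian‖
            ≤ Graphon.errorBound K τ ε N}) ∧
    (∀ γ : ℝ, 1 < γ →
      (0 < w.maxDegree → (w.thresholds K τ (Graphon.epsGamma γ)).Nonempty) ∧
      ∀ N : ℕ, 1 ≤ N → w.N₁' K τ γ ≤ N →
        1 - Graphon.epsGamma γ N ≤ (μ N).real {ω |
          ‖(Graphon.sparsity τ N)⁻¹ • (Graphon.ofGraph (G N ω)).laplacian - w.laplacian‖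
            ≤ Graphon.errorBound K τ (Graphon.epsGamma γ N) N}) := by
  have hτ' : 0 < 1 - τ := sub_pos.2 hτ1
  refine ⟨fun N hN => Graphon.norm_sampled_laplacian_sub_le hK.le hw hN, fun ε hε0 hε1 => ?_,
    fun γ _ => ?_⟩
  · have hne : 0 < w.maxDegree → (w.thresholds K τ fun _ => ε).Nonempty := fun hd =>
      Graphon.thresholds_nonempty hτ1 hd (fun _ => hε0)
        (((tendsto_rpow_atTop hτ').comp tendsto_natCast_atTop_atTop).const_div_atTop _)
    exact ⟨hne, fun N hN h => Graphon.one_sub_le_measureReal_of_sInf_thresholds_le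
      (ε := fun _ => ε) hK.le hw hτ0 hN hε0 hε1.le hne (hG N hN) h⟩
  · have hne : 0 < w.maxDegree → (w.thresholds K τ (Graphon.epsGamma γ)).Nonempty := fun hd => by
      refine Graphon.thresholds_nonempty hτ1 hd (Graphon.epsGamma_pos γ) ?_
      -- Any power of `log N` is negligible against `N ^ (1 - τ)`.
      have h1 := ((isLittleO_log_rpow_rpow_atTop γ hτ').tendsto_div_nhds_zero.comp
        tendsto_natCast_atTop_atTop).neg
      rw [neg_zero] at h1
      refine h1.congr fun N => ?_
      simp only [Function.comp_apply, Graphon.epsGamma, Real.log_exp, neg_div]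
    exact ⟨hne, fun N hN h => Graphon.one_sub_le_measureReal_of_sInf_thresholds_le
      hK.le hw hτ0 hN (Graphon.epsGamma_pos γ N) (Graphon.epsGamma_le_one γ N) hne (hG N hN) h⟩
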